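/- **Setting.** Signed queue sizes $Q_\ell(t)\in\mathbb Z$ at price levels $\ell\in\{1,\dots,N\}$ (ask queues positive, bid queues negative) form a limit order book with best ask $p_A=\min\{\ell:Q_\ell>0\}$ (or $N+1$), best bid $p_B=\max\{\ell:Q_\ell<0\}$ (or $0$), mid-price $p_M=(p_A+p_B)/2$ and spread $S=p_A-p_B$; paths are right-continuous step functions. Let $\{i,j\}=\{A,B\}$ and $s_0\ge 1$, with $S(0)=s_0$. An order that is never withdrawn rests on side $i$ one level deeper than the best quote; $W_{i-}(t)$ is its queue position (number of remaining orders up to and including it). Let $\tau^{\rm quote}_i$ be the first time the best quote of side $i$ moves away from the opposite side and $\tau_i^{\rm other}$ the first time of any other change of $p_A$ or $p_B$. Fix $m,n\ge 1$ and condition on the event (assumed of positive probability) that $\tau^{\rm quote}_i<\tau^{\rm other}_i$ and that at time $\tau_i^{\rm quote}$ the best quotes are $p'_A$ and $p'_B$ with $p'_A-p'_B=s_0+1$, that $W_{i-}(\tau_i^{\rm quote})=m$, and that the opposite best queue has size $Q_j(\tau_i^{\rm quote})=n$. Write $p_{i-}=p'_i$ and $p_j=p'_j$ for the best quotes of the two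 sides at that time. Let $$\tau^i=\inf\{t\ge\tau_i^{\rm quote}:p_M(t)\ne p_M(\tau_i^{\rm quote})\}-\tau_i^{\rm quote},\qquad \epsilon_{i-}=\inf\{u\ge 0: W_{i-}(\tau_i^{\rm quote}+u)=0\}.$$ **Order flow.** Let $\boldsymbol X_\ell$ be the factor vector at level $\ell$, a function of $\ell$ and the best quotes, and let $\lambda_k,\mu_k,\phi_k\ge 0$ be the limit, market and cancellation intensities (which may depend on the side) at queue size $k$. Conditionally on the above event there are independent: a pure-death process started at $m$ with death rates $\mu_k(\boldsymbol X_{p_{i-}})+\phi_k(\boldsymbol X_{p_{i-}})$; a (non-explosive) birth-death process started at $n$ with birth rates $\lambda_k(\boldsymbol X_{p_j})$ and death rates $\mu_k(\boldsymbol X_{p_j})+\phi_k(\boldsymbol X_{p_j})$, $k\ge1$; and, for $r=1,\dots,s_0$, exponential times of rate $\lambda_0(\boldsymbol X_{p'_A-r})$ (first sell order at level $p'_A-r$) and of rate $\lambda_0(\boldsymbol X_{p'_B+r})$ (first buy order at level $p'_B+r$), a time of rate $0$ being $\infty$. Up to and including the next mid-price move after $\tau_i^{\rm quote}$, the position $W_{i-}$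 equals the first process, the opposite best queue equals the second, each level inside the spread holds sell (buy) orders exactly once its sell (buy) time has passed, the queue at $p_{i-}$ contains at least the $W_{i-}$ orders up to and including the order considered, and there are no sell orders at levels $\le p'_B$ and no buy orders at levels $\ge p'_A$. Assume that the total arrival rate inside the spread is the same on both sides, $$\Lambda'_{s_0+1}=\sum_{r=1}^{s_0}\lambda_0(\boldsymbol X_{p'_A-r})=\sum_{r=1}^{s_0}\lambda_0(\boldsymbol X_{p'_B+r}).$$ Let $\hat g(s)=\mathbb E[e^{-s\epsilon};\epsilon<\infty]$ and $\hat f(s)=\mathbb E[e^{-s\sigma_j};\sigma_j<\infty]$ be the Laplace transforms of the first-passage times to $0$, $\epsilon$ of the pure-death process (from $m$) and $\sigma_j$ of the birth-death process (from $n$), and put $$\hat F(s)=\frac1s\,\hat g(s)\left(\hat f(2\Lambda'_{s_0+1}-s)+\frac{2\Lambda'_{s_0+1}}{2\Lambda'_{s_0+1}-s}\bigl(1-\hat f(2\Lambda'_{s_0+1}-s)\bigr)\right).$$ **Proposition.** Let $c>0$ be such that either $c<2\Lambda'_{s_0+1}$, or $c>2\Lambda'_{s_0+1}$, $\sigma_j<\infty$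 almost surely and $\mathbb E[e^{(c-2\Lambda'_{s_0+1})\sigma_j}]<\infty$. Then the conditional probability that the order is filled with no earlier mid-price move is the inverse Laplace transform of $\hat F$ evaluated at $0$: $$\mathbb P\bigl[\epsilon_{i-}<\infty,\ \epsilon_{i-}\le\tau^i\mid W_{i-}(\tau_i^{\rm quote})=m,\,Q_j(\tau_i^{\rm quote})=n\bigr]=\lim_{R\to\infty}\frac1{2\pi}\int_{-R}^{R}\hat F(c+iy)\,dy$$ (in $c+iy$, $i$ is the imaginary unit), where $\mathbb P[\,\cdot\mid\cdot\,]$ is conditional on the whole event above and the integrals exist. If, moreover, almost surely under this conditional law the queue at $p_{i-}$ is not empty at the moment of the fill whenever $\epsilon_{i-}<\infty$ and $\epsilon_{i-}\le\tau^i$, then the same limit equals $\mathbb P[\epsilon_{i-}<\tau^i\mid W_{i-}(\tau_i^{\rm quote})=m,\,Q_j(\tau_i^{\rm quote})=n]$. -/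

import Mathlib

open MeasureTheory ProbabilityTheory Filter Topology
open scoped NNReal ENNReal

namespace LimitOrderBook

/-! ### The order book -/

/-- The two sides of the book. -/
inductive Side
  | ask
  | bid

/-- The opposite side. -/
def Side.opp : Side → Side
  | .ask => .bid
  | .bid => .ask

/-- Ask queues are counted positively, bid queues negatively. -/
def Side.sign : Side → ℤ
  | .ask => 1
  | .bid => -1

/-- A book state: the signed queue size at each price level. Only levels `1, …, N` are used. -/
abbrev Book := ℕ → ℤ

/-- Best ask: the lowest level in `{1, …, N}` holding sell orders, and `N + 1` if there is none. -/
noncomputable def bestAsk (N : ℕ) (x : Book) : ℕ :=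
  sInf ({l | 1 ≤ l ∧ l ≤ N ∧ 0 < x l} ∪ {N + 1})

/-- Best bid: the highest level in `{1, …, N}` holding buy orders, and `0` if there is none. -/
noncomputable def bestBid (N : ℕ) (x : Book) : ℕ :=
  sSup ({l | 1 ≤ l ∧ l ≤ N ∧ x l < 0} ∪ {0})

/-- The mid-price. -/
noncomputable def midPrice (N : ℕ) (x : Book) : ℝ :=
  ((bestBid N x : ℝ) + (bestAsk N x : ℝ)) / 2

/-- The bid-ask spread. -/
noncomputable def spread (N : ℕ) (x : Book) : ℤ :=
  (bestAsk N x : ℤ) - (bestBid N x : ℤ)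

/-- Among a best ask `a` and a best bid `b`, the quote of the given side. -/
def Side.quote (a b : ℕ) : Side → ℕ
  | .ask => a
  | .bid => b

/-- The level strictly inside the spread which is `r + 1` ticks away from the best quote of the
given side; an order of that side posted there improves that best quote. -/
def Side.insideLevel (a b : ℕ) : Side → ℕ → ℕ
  | .ask, r => a - (r + 1)
  | .bid, r => b + (r + 1)

/-! ### Random times attached to a trajectory -/

/-- `inf {t ≥ 0 : A t}`, equal to `∞` if `A` never holds. -/
noncomputable def firstTime (A : ℝ≥0 → Prop) : ℝ≥0∞ :=
  ⨅ (t : ℝ≥0) (_ : A t), (t : ℝ≥0∞)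

/-- First time the best quote of side `i` moves away from the opposite side
(the ask moves up, respectively the bid moves down). -/
noncomputable def quoteTime (N : ℕ) : Side → (ℝ≥0 → Book) → ℝ≥0∞
  | .ask, x => firstTime fun t => bestAsk N (x 0) < bestAsk N (x t)
  | .bid, x => firstTime fun t => bestBid N (x t) < bestBid N (x 0)

/-- First time of any other change of the best quotes. -/
noncomputable def otherTime (N : ℕ) : Side → (ℝ≥0 → Book) → ℝ≥0∞
  | .ask, x => firstTime fun t =>
      bestAsk N (x t) < bestAsk N (x 0) ∨ bestBid N (x t) ≠ bestBid N (x 0)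
  | .bid, x => firstTime fun t =>
      bestBid N (x 0) < bestBid N (x t) ∨ bestAsk N (x t) ≠ bestAsk N (x 0)

variable {Ω : Type*}

/-- The quote time `τ_quote` as a clock value (used only where it is finite). -/
noncomputable def quoteClock (N : ℕ) (i : Side) (Q : ℝ≥0 → Ω → Book) (ω : Ω) : ℝ≥0 :=
  (quoteTime N i fun t => Q t ω).toNNReal

/-- The book `u` units of time after the quote time. -/
noncomputable def shiftedBook (N : ℕ) (i : Side) (Q : ℝ≥0 → Ω → Book) (u : ℝ≥0) (ω : Ω) : Book :=
  Q (quoteClock N i Q ω + u) ω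

/-- The order's queue position `u` units of time after the quote time. -/
noncomputable def shiftedPosition (N : ℕ) (i : Side) (Q : ℝ≥0 → Ω → Book) (W : ℝ≥0 → Ω → ℕ)
    (u : ℝ≥0) (ω : Ω) : ℕ :=
  W (quoteClock N i Q ω + u) ω

/-- `τ^i`: the time from `τ_quote` to the next change of the mid-price. -/
noncomputable def nextMove (N : ℕ) (i : Side) (Q : ℝ≥0 → Ω → Book) (ω : Ω) : ℝ≥0∞ :=
  firstTime fun u => midPrice N (shiftedBook N i Q u ω) ≠ midPrice N (shiftedBook N i Q 0 ω)

/-- `ε_{i-}`: the time from `τ_quote` until the order's queue position reaches `0`. -/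
noncomputable def fillTime (N : ℕ) (i : Side) (Q : ℝ≥0 → Ω → Book) (W : ℝ≥0 → Ω → ℕ)
    (ω : Ω) : ℝ≥0∞ :=
  firstTime fun u => shiftedPosition N i Q W u ω = 0

/-- The conditioning event: the initial spread is `s₀`, the quote of side `i` moves away before
anything else moves the best quotes, and at that time the best ask is `a`, the best bid is `b`,
the order's position is `m` and the opposite best queue has size `n`. -/
def quoteEvent (N : ℕ) (i : Side) (Q : ℝ≥0 → Ω → Book) (W : ℝ≥0 → Ω → ℕ)
    (s₀ a b m n : ℕ) : Set Ω :=
  {ω | spread N (Q 0 ω) = s₀ ∧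
    quoteTime N i (fun t => Q t ω) < otherTime N i (fun t => Q t ω) ∧
    bestAsk N (shiftedBook N i Q 0 ω) = a ∧
    bestBid N (shiftedBook N i Q 0 ω) = b ∧
    shiftedPosition N i Q W 0 ω = m ∧
    (shiftedBook N i Q 0 ω (i.opp.quote a b)).natAbs = n}

/-! ### Birth-death processes, pure-death processes and exponential clocks -/

/-- The generator of the birth-death process on `ℕ` with birth rates `β k` and death rates `δ k`
(no death from state `0`). -/
def birthDeathGenerator (β δ : ℕ → ℝ≥0) (x y : ℕ) : ℝ :=
  if y = x + 1 then β x
  else if x = y + 1 then δ x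
  else if x = y then -((β x : ℝ) + if x = 0 then 0 else (δ x : ℝ))
  else 0

/-- `p` is an honest transition function on `ℕ` whose derivative at time `0` is `q`. -/
structure IsTransitionFunction (p : ℝ≥0 → ℕ → ℕ → ℝ) (q : ℕ → ℕ → ℝ) : Prop where
  nonneg : ∀ t x y, 0 ≤ p t x y
  hasSum_one : ∀ t x, HasSum (p t x) 1
  zero : ∀ x y, p 0 x y = if x = y then 1 else 0
  chapman_kolmogorov : ∀ s t x z, HasSum (fun y => p s x y * p t y z) (p (s + t) x z)
  deriv_zero : ∀ x y,
    Tendsto (fun h : ℝ≥0 => (p h x y - p 0 x y) / (h : ℝ)) (𝓝[>] 0) (𝓝 (q x y))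

/-- `Z` is a time-homogeneous continuous-time Markov chain on `ℕ` with generator `q`, started at
`x₀`. Its paths are right-continuous with left limits in the discrete space `ℕ`, so that it makes
finitely many jumps in bounded time. -/
structure IsMarkovJumpProcess [MeasurableSpace Ω] (P : Measure Ω) (Z : ℝ≥0 → Ω → ℕ) (x₀ : ℕ)
    (q : ℕ → ℕ → ℝ) : Prop where
  measurable : ∀ t, Measurable (Z t)
  start : ∀ᵐ ω ∂P, Z 0 ω = x₀
  right_continuous : ∀ ω t, ∀ᶠ u in 𝓝[>] t, Z u ω = Z t ω
  left_limit : ∀ ω t, 0 < t → ∃ x, ∀ᶠ u in 𝓝[<] t, Z u ω = x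
  markov : ∃ p, IsTransitionFunction p q ∧
    ∀ (s t : ℝ≥0) (x y : ℕ) (A : Set Ω),
      MeasurableSet[⨆ (u : ℝ≥0) (_ : u ≤ s), MeasurableSpace.comap (Z u) ⊤] A →
      P.real (A ∩ {ω | Z s ω = x} ∩ {ω | Z (s + t) ω = y})
        = P.real (A ∩ {ω | Z s ω = x}) * p t x y

/-- Birth-death process with birth rates `β`, death rates `δ`, started at `x₀`. -/
def IsBirthDeathProcess [MeasurableSpace Ω] (P : Measure Ω) (Z : ℝ≥0 → Ω → ℕ) (x₀ : ℕ)
    (β δ : ℕ → ℝ≥0) : Prop :=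
  IsMarkovJumpProcess P Z x₀ (birthDeathGenerator β δ)

/-- Pure-death process with death rates `δ`, started at `x₀`. -/
def IsPureDeathProcess [MeasurableSpace Ω] (P : Measure Ω) (Z : ℝ≥0 → Ω → ℕ) (x₀ : ℕ)
    (δ : ℕ → ℝ≥0) : Prop :=
  IsMarkovJumpProcess P Z x₀ (birthDeathGenerator (fun _ => 0) δ)

/-- First passage time to `0`. -/
noncomputable def passageTime (Z : ℝ≥0 → Ω → ℕ) (ω : Ω) : ℝ≥0∞ :=
  firstTime fun t => Z t ω = 0

/-- `T` is exponentially distributed with the given rate (rate `0`: `T = ∞` almost surely). -/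
structure IsExponentialTime [MeasurableSpace Ω] (P : Measure Ω) (T : Ω → ℝ≥0∞) (rate : ℝ≥0) :
    Prop where
  measurable : Measurable T
  tail : ∀ t : ℝ≥0, P.real {ω | (t : ℝ≥0∞) < T ω} = Real.exp (-(rate * t))

/-! ### Order flow after the quote time -/

/-- State-dependent intensities of limit orders, market orders and cancellations, by side, size of
the queue concerned, and value of the factor vector at its price level. -/
structure Intensities (𝒳 : Type*) where
  lam : Side → ℕ → 𝒳 → ℝ≥0
  mu : Side → ℕ → 𝒳 → ℝ≥0
  phi : Side → ℕ → 𝒳 → ℝ≥0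

/-- Labels of the independent sources of randomness. -/
inductive Driver (s₀ : ℕ)
  | position
  | opposite
  | arrival (k : Side) (r : Fin s₀)

/-- The information generated by each source of randomness. -/
@[reducible] def driverSigma {s₀ : ℕ} (D B : ℝ≥0 → Ω → ℕ) (T : Side → Fin s₀ → Ω → ℝ≥0∞) :
    Driver s₀ → MeasurableSpace Ω
  | .position => ⨆ t, MeasurableSpace.comap (D t) ⊤
  | .opposite => ⨆ t, MeasurableSpace.comap (B t) ⊤
  | .arrival k r => MeasurableSpace.comap (T k r) inferInstance

/-- The order flow after the quote time, under the conditional law `P` of the model given the state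
at that time (best ask `a`, best bid `b`, order's position `m`, opposite best queue `n`).

`X l a b` is the factor vector at level `l` while the best quotes are `a` and `b`.
Independently of each other, `D` drives the order's position, `B` drives the opposite best queue,
and `T k r` is the first arrival of an order of side `k` at the level inside the spread which is
`r + 1` ticks from the best quote of side `k`. They govern the book up to and including the next
mid-price move; nothing is required of the book after that move. -/
structure PostQuoteFlow [MeasurableSpace Ω] {𝒳 : Type*} (P : Measure Ω) (N : ℕ) (i : Side)
    (Q : ℝ≥0 → Ω → Book) (W : ℝ≥0 → Ω → ℕ) (R : Intensities 𝒳) (X : ℕ → ℕ → ℕ → 𝒳)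
    (s₀ a b m n : ℕ) (D B : ℝ≥0 → Ω → ℕ) (T : Side → Fin s₀ → Ω → ℝ≥0∞) : Prop where
  /-- The order, at the new best quote, advances by market orders and cancellations. -/
  position_law : IsPureDeathProcess P D m
    (fun k => R.mu i k (X (i.quote a b) a b) + R.phi i k (X (i.quote a b) a b))
  /-- The opposite best queue is a birth-death process. -/
  opposite_law : IsBirthDeathProcess P B n
    (fun k => R.lam i.opp k (X (i.opp.quote a b) a b))
    (fun k => R.mu i.opp k (X (i.opp.quote a b) a b) + R.phi i.opp k (X (i.opp.quote a b) a b))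
  /-- Orders arrive at the empty levels inside the spread at exponential times. -/
  arrival_law : ∀ k r, IsExponentialTime P (T k r) (R.lam k 0 (X (k.insideLevel a b r) a b))
  independent : iIndep (driverSigma D B T) P
  position_eq : ∀ᵐ ω ∂P, ∀ u : ℝ≥0, (u : ℝ≥0∞) ≤ nextMove N i Q ω →
    shiftedPosition N i Q W u ω = D u ω
  opposite_eq : ∀ᵐ ω ∂P, ∀ u : ℝ≥0, (u : ℝ≥0∞) ≤ nextMove N i Q ω →
    shiftedBook N i Q u ω (i.opp.quote a b) = i.opp.sign * (B u ω : ℤ)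
  /-- A level inside the spread holds orders of side `k` once such an order has arrived. -/
  inside_iff : ∀ᵐ ω ∂P, ∀ u : ℝ≥0, (u : ℝ≥0∞) ≤ nextMove N i Q ω → ∀ k r,
    (0 < k.sign * shiftedBook N i Q u ω (k.insideLevel a b r) ↔ T k r ω ≤ u)
  /-- The orders up to and including the concerned order are part of the queue at its level;
  there may be further ones behind it. -/
  own_queue : ∀ᵐ ω ∂P, ∀ u : ℝ≥0, (u : ℝ≥0∞) ≤ nextMove N i Q ω →
    (D u ω : ℤ) ≤ i.sign * shiftedBook N i Q u ω (i.quote a b)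
  /-- No sell order is posted at or below the bid and no buy order at or above the ask. -/
  no_crossing : ∀ᵐ ω ∂P, ∀ u : ℝ≥0, (u : ℝ≥0∞) ≤ nextMove N i Q ω → ∀ l,
    (l ≤ b → shiftedBook N i Q u ω l ≤ 0) ∧ (a ≤ l → 0 ≤ shiftedBook N i Q u ω l)

/-! ### Laplace transforms -/

/-- Laplace transform of the (possibly defective) law of a random time `T` on `[0, ∞)`. -/
noncomputable def laplace [MeasurableSpace Ω] (P : Measure Ω) (T : Ω → ℝ≥0∞) (s : ℂ) : ℂ :=
  ∫ ω in {ω | T ω < ∞}, Complex.exp (-s * ((T ω).toReal : ℂ)) ∂P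

/-- The inverse Laplace transform of `F` along the line `Re s = c`, evaluated at `t`, exists and
equals `v`: the Bromwich integral converges to `v` as a symmetric limit. -/
def HasInverseLaplaceAt (F : ℂ → ℂ) (c t : ℝ) (v : ℂ) : Prop :=
  (∀ r : ℝ, IntervalIntegrable
    (fun y : ℝ => Complex.exp ((c + y * Complex.I) * t) * F (c + y * Complex.I)) volume (-r) r) ∧
  Tendsto (fun r : ℝ => (1 / (2 * Real.pi) : ℂ) *
      ∫ y in (-r)..r, Complex.exp ((c + y * Complex.I) * t) * F (c + y * Complex.I))
    atTop (𝓝 v)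

/-- `(1/s) ĝ(s) ( f̂(2Λ - s) + 2Λ/(2Λ - s) (1 - f̂(2Λ - s)) )`. -/
noncomputable def fillTransform (g f : ℂ → ℂ) (Λ : ℝ) (s : ℂ) : ℂ :=
  (1 / s) * g s *
    (f (2 * Λ - s) + (2 * Λ) / (2 * Λ - s) * (1 - f (2 * Λ - s)))

end LimitOrderBook

open LimitOrderBook

/-
As long as the order's own queue is not empty, the mid-price first moves when the opposite best
queue is depleted or an order arrives inside the spread. So, ties having probability zero, the order
is filled without an earlier move iff `ε < M`, where `ε` is its own passage time and `M` is the
minimum of the depletion time `σ` and of the arrival times, which is independent of `ε` and has the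
survival function `P(σ > t) exp (-2Λt)`. Integrating by parts, the bracket in `fillTransform` is
`E[exp (sM)]`, whence the transform equals `E[exp (s(M - ε)); ε < ∞] / s`. Finally the truncated
integrals of `exp (sx) / s` along `Re s = c` are dominated by a multiple of `exp (cx)` and converge
to `2π` if `x > 0` and to `0` if `x < 0`; Fubini and dominated convergence give `P(M - ε > 0)`.
-/

namespace LimitOrderBook

/-! ### The Bromwich kernel -/

section Bromwich

open Complex (I)

/-- The Bromwich integral of `exp (s x) / s` along the line `Re s = c`, truncated to
`|Im s| ≤ r`. -/
noncomputable def bromwichKernel (c x r : ℝ) : ℂ :=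
  ∫ y in (-r)..r, Complex.exp ((c + y * I) * x) / (c + y * I)

variable {c x r : ℝ}

lemma re_add_mul_I_ne_zero (hc : c ≠ 0) (y : ℝ) : (c + y * I : ℂ) ≠ 0 := fun h =>
  hc (by simpa using congrArg Complex.re h)

lemma im_add_mul_I_ne_zero (u : ℝ) {v : ℝ} (hv : v ≠ 0) : (u + v * I : ℂ) ≠ 0 := fun h =>
  hv (by simpa using congrArg Complex.im h)

lemma abs_re_le_norm_add_mul_I (u v : ℝ) : |u| ≤ ‖(u + v * I : ℂ)‖ := by
  simpa using Complex.abs_re_le_norm (u + v * I : ℂ)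

lemma abs_im_le_norm_add_mul_I (u v : ℝ) : |v| ≤ ‖(u + v * I : ℂ)‖ := by
  simpa using Complex.abs_im_le_norm (u + v * I : ℂ)

lemma norm_exp_line (u v x : ℝ) : ‖Complex.exp ((u + v * I) * x)‖ = Real.exp (u * x) := by
  simp [Complex.norm_exp]

lemma norm_exp_line_div_le_re (hc : 0 < c) (x y : ℝ) :
    ‖Complex.exp ((c + y * I) * x) / (c + y * I)‖ ≤ Real.exp (c * x) / c := by
  rw [norm_div, norm_exp_line]
  gcongr
  exact (le_abs_self c).trans (abs_re_le_norm_add_mul_I c y)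

lemma norm_exp_line_div_le_im {v : ℝ} (hv : v ≠ 0) (u x : ℝ) :
    ‖Complex.exp ((u + v * I) * x) / (u + v * I)‖ ≤ Real.exp (u * x) / |v| := by
  rw [norm_div, norm_exp_line]
  have := abs_pos.mpr hv
  gcongr
  exact abs_im_le_norm_add_mul_I u v

lemma continuous_exp_line_div (hc : c ≠ 0) (x : ℝ) :
    Continuous fun y : ℝ => Complex.exp ((c + y * I) * x) / (c + y * I) :=
  .div (by fun_prop) (by fun_prop) (re_add_mul_I_ne_zero hc)

lemma norm_integral_vertical_sub_le {f : ℂ → ℂ} {a b r : ℝ} {g : ℝ → ℝ} (hab : a ≤ b)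
    (hr : 0 ≤ r) (hf : DifferentiableOn ℂ f (Set.uIcc a b ×ℂ Set.uIcc (-r) r))
    (hg : IntervalIntegrable g volume a b)
    (hfg : ∀ v, |v| = r → ∀ u ∈ Set.Ioc a b, ‖f (u + v * I)‖ ≤ g u) :
    ‖(∫ y in (-r)..r, f (a + y * I)) - ∫ y in (-r)..r, f (b + y * I)‖
      ≤ 2 * ∫ u in a..b, g u := by
  have horizontal (v : ℝ) (hv : |v| = r) :
      ‖∫ u in a..b, f (u + v * I)‖ ≤ ∫ u in a..b, g u :=
    intervalIntegral.norm_integral_le_of_norm_le hab (.of_forall (hfg v hv)) hg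
  have cauchy := Complex.integral_boundary_rect_eq_zero_of_differentiableOn f ⟨a, -r⟩ ⟨b, r⟩ hf
  simp only [smul_eq_mul] at cauchy
  calc ‖(∫ y in (-r)..r, f (a + y * I)) - ∫ y in (-r)..r, f (b + y * I)‖
      = ‖I * ((∫ y in (-r)..r, f (a + y * I)) - ∫ y in (-r)..r, f (b + y * I))‖ := by simp
    _ = ‖(∫ u in a..b, f (u + (-r : ℝ) * I)) - ∫ u in a..b, f (u + r * I)‖ := by
        congr 1
        linear_combination -cauchy
    _ ≤ 2 * ∫ u in a..b, g u := by
        refine (norm_sub_le _ _).trans ?_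
        linarith [horizontal (-r) (by rw [abs_neg, abs_of_nonneg hr]),
          horizontal r (abs_of_nonneg hr)]

lemma norm_bromwichKernel_le_mul_exp (hc : 0 < c) (hr : 0 ≤ r) :
    ‖bromwichKernel c x r‖ ≤ 2 * r / c * Real.exp (c * x) := by
  refine (intervalIntegral.norm_integral_le_of_norm_le_const fun y _ =>
    norm_exp_line_div_le_re hc x y).trans (le_of_eq ?_)
  rw [sub_neg_eq_add, abs_of_nonneg (by linarith)]
  ring

lemma norm_bromwichKernel_sub_le {l : ℝ} (hc : 0 < c) (hl : c ≤ l) (hx : x < 0) (hr : 0 < r) :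
    ‖bromwichKernel c x r - bromwichKernel l x r‖ ≤ 2 * Real.exp (c * x) / (-x * r) := by
  have holomorphic : DifferentiableOn ℂ (fun s : ℂ => Complex.exp (s * x) / s)
      (Set.uIcc c l ×ℂ Set.uIcc (-r) r) := by
    intro s hs
    have hre : c ≤ s.re := (Set.uIcc_of_le hl ▸ hs.1 : s.re ∈ Set.Icc c l).1
    have hs0 : s ≠ 0 := fun h => (hc.trans_le hre).ne' (by simp [h])
    exact DifferentiableAt.differentiableWithinAt (by fun_prop (disch := exact hs0))
  have integral_bound : ∫ u in c..l, Real.exp (u * x) / r ≤ Real.exp (c * x) / (-x * r) := by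
    rw [intervalIntegral.integral_div, intervalIntegral.integral_comp_mul_right _ hx.ne,
      integral_exp, smul_eq_mul, inv_mul_eq_div, div_div, ← neg_div_neg_eq, ← neg_mul]
    have := neg_pos.mpr hx
    gcongr
    linarith [Real.exp_pos (l * x)]
  refine (norm_integral_vertical_sub_le hl hr.le holomorphic
    (Continuous.intervalIntegrable (by fun_prop) c l) fun v hv u _ => ?_).trans
    ((mul_le_mul_of_nonneg_left integral_bound zero_le_two).trans_eq (mul_div_assoc _ _ _).symm)
  have hv0 : v ≠ 0 := abs_pos.mp (hv ▸ hr)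
  simpa only [hv] using norm_exp_line_div_le_im hv0 u x

lemma norm_bromwichKernel_le_of_neg (hc : 0 < c) (hx : x < 0) (hr : 0 < r) :
    ‖bromwichKernel c x r‖ ≤ 2 * Real.exp (c * x) / (-x * r) := by
  have far_line : Tendsto (fun l => bromwichKernel l x r) atTop (𝓝 0) := by
    refine squeeze_zero_norm' (a := fun l => 2 * r / l * Real.exp (l * x)) ?_ ?_
    · filter_upwards [eventually_gt_atTop 0] with l hl using norm_bromwichKernel_le_mul_exp hl hr.le
    · simpa using (tendsto_const_nhds.div_atTop tendsto_id).mul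
        (Real.tendsto_exp_atBot.comp (tendsto_id.atTop_mul_const_of_neg hx))
  refine le_of_tendsto (by simpa using (far_line.const_sub (bromwichKernel c x r)).norm) ?_
  filter_upwards [eventually_ge_atTop c] with l hl using norm_bromwichKernel_sub_le hc hl hx hr

lemma bromwichKernel_neg_left (c x r : ℝ) :
    bromwichKernel (-c) x r = -bromwichKernel c (-x) r := by
  have reflect := intervalIntegral.integral_comp_neg (a := -r) (b := r)
    fun y : ℝ => Complex.exp (((-c : ℝ) + y * I) * x) / ((-c : ℝ) + y * I)
  rw [neg_neg] at reflect
  rw [bromwichKernel, ← reflect, bromwichKernel, ← intervalIntegral.integral_neg]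
  congr 1 with y
  have hs : ((-c : ℝ) + (-y : ℝ) * I : ℂ) = -(c + y * I) := by push_cast; ring
  rw [hs, div_neg, Complex.ofReal_neg, mul_neg, neg_mul]

lemma bromwichKernel_zero (hc : c ≠ 0) :
    bromwichKernel c 0 r = ((2 * Real.arctan (r / c) : ℝ) : ℂ) := by
  have hsq (y : ℝ) : c ^ 2 + y ^ 2 ≠ 0 := by positivity
  have antideriv (y : ℝ) : HasDerivAt
      (fun y : ℝ => (Real.arctan (y / c) : ℂ) - ((Real.log (c ^ 2 + y ^ 2) / 2 : ℝ) : ℂ) * I)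
      (1 / (c + y * I)) y := by
    have harctan : HasDerivAt (fun y : ℝ => Real.arctan (y / c)) (c / (c ^ 2 + y ^ 2)) y := by
      convert! ((hasDerivAt_id y).div_const c).arctan using 1
      have : 1 + (y / c) ^ 2 ≠ 0 := by positivity
      have := hsq y
      simp only [id]
      field_simp
    have hlog : HasDerivAt (fun y : ℝ => Real.log (c ^ 2 + y ^ 2) / 2) (y / (c ^ 2 + y ^ 2)) y := by
      convert! ((((hasDerivAt_id y).pow 2).const_add (c ^ 2)).log (hsq y)).div_const 2 using 1
      simp only [id, Pi.pow_apply]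
      ring
    convert! harctan.ofReal_comp.sub (hlog.ofReal_comp.mul_const I) using 1
    have hfactor : ((c ^ 2 + y ^ 2 : ℝ) : ℂ) = (c + y * I) * (c - y * I) := by
      push_cast
      linear_combination (y : ℂ) ^ 2 * Complex.I_sq
    have h₁ := re_add_mul_I_ne_zero hc y
    have h₂ : (c - y * I : ℂ) ≠ 0 := by simpa [sub_eq_add_neg] using re_add_mul_I_ne_zero hc (-y)
    rw [Complex.ofReal_div, Complex.ofReal_div, hfactor]
    field_simp
  have := intervalIntegral.integral_eq_sub_of_hasDerivAt (a := -r) (b := r)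
    (fun y _ => antideriv y)
    ((by simpa using continuous_exp_line_div hc 0 : Continuous _).intervalIntegrable _ _)
  simp only [bromwichKernel, Complex.ofReal_zero, mul_zero, Complex.exp_zero, this, neg_div,
    Real.arctan_neg, even_two.neg_pow]
  push_cast
  ring

lemma norm_bromwichKernel_zero_le (hc : c ≠ 0) : ‖bromwichKernel c 0 r‖ ≤ Real.pi := by
  rw [bromwichKernel_zero hc, Complex.norm_real, Real.norm_eq_abs, abs_le]
  constructor <;>
  linarith [Real.arctan_lt_pi_div_two (r / c), Real.neg_pi_div_two_lt_arctan (r / c)]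

lemma dslope_exp_mul_zero (x : ℝ) {s : ℂ} (hs : s ≠ 0) :
    dslope (fun s : ℂ => Complex.exp (s * x)) 0 s = (Complex.exp (s * x) - 1) / s := by
  simp [dslope_of_ne _ hs, slope_def_field]

lemma differentiable_dslope_exp_mul_zero (x : ℝ) :
    Differentiable ℂ (dslope (fun s : ℂ => Complex.exp (s * x)) 0) := by
  rw [← differentiableOn_univ, Complex.differentiableOn_dslope univ_mem]
  fun_prop

lemma integral_dslope_exp_mul_zero (hc : c ≠ 0) (x r : ℝ) :
    ∫ y in (-r)..r, dslope (fun s : ℂ => Complex.exp (s * x)) 0 (c + y * I)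
      = bromwichKernel c x r - bromwichKernel c 0 r := by
  have integrable (z : ℝ) := (continuous_exp_line_div hc z).intervalIntegrable (μ := volume) (-r) r
  rw [bromwichKernel, bromwichKernel, ← intervalIntegral.integral_sub (integrable x) (integrable 0)]
  congr 1 with y
  simp [dslope_exp_mul_zero x (re_add_mul_I_ne_zero hc y), sub_div]

lemma norm_bromwichKernel_add_neg_sub_le (hc : 0 < c) (hx : 0 ≤ x) (hr : 0 < r) :
    ‖bromwichKernel c x r + bromwichKernel c (-x) r - 2 * bromwichKernel c 0 r‖
      ≤ 8 * c * Real.exp (c * x) / r := by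
  have norm_dslope_le (v : ℝ) (hv : |v| = r) (u : ℝ) (hu : u ∈ Set.Ioc (-c) c) :
      ‖dslope (fun s : ℂ => Complex.exp (s * x)) 0 (u + v * I)‖ ≤ 2 * Real.exp (c * x) / r := by
    rw [dslope_exp_mul_zero x (im_add_mul_I_ne_zero u (abs_pos.mp (hv ▸ hr))), norm_div]
    gcongr
    · have hone : 1 ≤ Real.exp (c * x) := Real.one_le_exp (by positivity)
      have hexp : Real.exp (u * x) ≤ Real.exp (c * x) := by gcongr; exact hu.2
      refine (norm_sub_le _ _).trans ?_
      rw [norm_exp_line, norm_one]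
      linarith
    · exact hv ▸ abs_im_le_norm_add_mul_I u v
  have := norm_integral_vertical_sub_le (by linarith : -c ≤ c) hr.le
    (differentiable_dslope_exp_mul_zero x).differentiableOn
    intervalIntegrable_const norm_dslope_le
  rw [integral_dslope_exp_mul_zero (neg_ne_zero.mpr hc.ne'), integral_dslope_exp_mul_zero hc.ne',
    bromwichKernel_neg_left, bromwichKernel_neg_left, neg_zero, norm_sub_rev,
    intervalIntegral.integral_const, smul_eq_mul] at this
  refine (le_of_eq (congrArg norm (by ring))).trans (this.trans_eq (by ring))

lemma norm_bromwichKernel_le_of_abs_mul_le_one (hc : 0 < c) (hr : 0 < r) (hx : |x| * r ≤ 1) :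
    ‖bromwichKernel c x r‖ ≤ (Real.pi + 2) * Real.exp (c * x) := by
  have decomposition : bromwichKernel c x r = Complex.exp ((c + (0 : ℝ) * I) * x) *
      (bromwichKernel c 0 r +
        ∫ y in (-r)..r, (Complex.exp (I * (y * x : ℝ)) - 1) / (c + y * I)) := by
    have continuous_remainder :
        Continuous fun y : ℝ => (Complex.exp (I * (y * x : ℝ)) - 1) / (c + y * I) :=
      .div (by fun_prop) (by fun_prop) (re_add_mul_I_ne_zero hc.ne')
    rw [bromwichKernel, bromwichKernel, ← intervalIntegral.integral_add
      ((continuous_exp_line_div hc.ne' 0).intervalIntegrable _ _)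
      (continuous_remainder.intervalIntegrable _ _), ← intervalIntegral.integral_const_mul]
    congr 1 with y
    rw [← add_div, ← mul_div_assoc, Complex.ofReal_zero, mul_zero, Complex.exp_zero,
      add_sub_cancel, ← Complex.exp_add]
    congr 2
    push_cast
    ring
  have remainder_le (y : ℝ) (_ : y ∈ Set.uIoc (-r) r) :
      ‖(Complex.exp (I * (y * x : ℝ)) - 1) / (c + y * I)‖ ≤ |x| := by
    rw [norm_div, div_le_iff₀ (norm_pos_iff.mpr (re_add_mul_I_ne_zero hc.ne' y))]
    calc ‖Complex.exp (I * (y * x : ℝ)) - 1‖ ≤ |x| * |y| := by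
          simpa [abs_mul, mul_comm] using Real.norm_exp_I_mul_ofReal_sub_one_le (x := y * x)
      _ ≤ |x| * ‖(c + y * I : ℂ)‖ := by gcongr; exact abs_im_le_norm_add_mul_I c y
  have integral_le := intervalIntegral.norm_integral_le_of_norm_le_const remainder_le
  rw [sub_neg_eq_add, ← two_mul, abs_of_pos (by linarith : 0 < 2 * r)] at integral_le
  rw [decomposition, norm_mul, norm_exp_line, mul_comm]
  refine mul_le_mul_of_nonneg_right ?_ (Real.exp_pos _).le
  linarith [norm_add_le (bromwichKernel c 0 r)
    (∫ y in (-r)..r, (Complex.exp (I * (y * x : ℝ)) - 1) / (c + y * I)),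
    norm_bromwichKernel_zero_le (r := r) hc.ne']

lemma norm_bromwichKernel_le (hc : 0 < c) (hr : 1 ≤ r) (x : ℝ) :
    ‖bromwichKernel c x r‖ ≤ (4 + 2 * Real.pi + 8 * c) * Real.exp (c * x) := by
  have hr₀ : 0 < r := by linarith
  have hpi := Real.pi_pos
  have neg_case (z : ℝ) (hz : z < 0) (hzr : 1 < |z| * r) :
      ‖bromwichKernel c z r‖ ≤ 2 * Real.exp (c * z) := by
    refine (norm_bromwichKernel_le_of_neg hc hz hr₀).trans ?_
    rw [abs_of_neg hz] at hzr
    exact div_le_self (by positivity) hzr.le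
  rcases le_or_gt (|x| * r) 1 with hsmall | hlarge
  · refine (norm_bromwichKernel_le_of_abs_mul_le_one hc hr₀ hsmall).trans ?_
    exact mul_le_mul_of_nonneg_right (by linarith) (Real.exp_pos _).le
  rcases lt_or_ge x 0 with hx | hx
  · refine (neg_case x hx hlarge).trans ?_
    gcongr
    linarith
  · have hx₀ : 0 < x := hx.lt_of_ne' (by rintro rfl; simp at hlarge; linarith)
    have hsum : ‖bromwichKernel c x r + bromwichKernel c (-x) r - 2 * bromwichKernel c 0 r‖
        ≤ 8 * c * Real.exp (c * x) :=
      (norm_bromwichKernel_add_neg_sub_le hc hx hr₀).trans (div_le_self (by positivity) hr)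
    have hneg := neg_case (-x) (by linarith) (by rwa [abs_neg])
    have hzero := norm_bromwichKernel_zero_le (r := r) hc.ne'
    have hexp : Real.exp (c * -x) ≤ Real.exp (c * x) := by gcongr; linarith
    have hone : 1 ≤ Real.exp (c * x) := Real.one_le_exp (by positivity)
    calc ‖bromwichKernel c x r‖
        = ‖(bromwichKernel c x r + bromwichKernel c (-x) r - 2 * bromwichKernel c 0 r)
            - bromwichKernel c (-x) r + 2 * bromwichKernel c 0 r‖ := by congr 1; ring
      _ ≤ 8 * c * Real.exp (c * x) + 2 * Real.exp (c * x) + 2 * Real.pi := by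
        refine (norm_add_le _ _).trans (add_le_add ((norm_sub_le _ _).trans ?_) ?_)
        · linarith
        · simpa using hzero
      _ ≤ (4 + 2 * Real.pi + 8 * c) * Real.exp (c * x) := by nlinarith

lemma tendsto_bromwichKernel_of_neg (hc : 0 < c) (hx : x < 0) :
    Tendsto (bromwichKernel c x) atTop (𝓝 0) := by
  refine squeeze_zero_norm' (a := fun r => 2 * Real.exp (c * x) / (-x * r)) ?_ ?_
  · filter_upwards [eventually_gt_atTop 0] with r hr using norm_bromwichKernel_le_of_neg hc hx hr
  · exact tendsto_const_nhds.div_atTop (tendsto_id.const_mul_atTop (by linarith))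

lemma tendsto_bromwichKernel_zero (hc : 0 < c) :
    Tendsto (bromwichKernel c 0) atTop (𝓝 (Real.pi : ℂ)) := by
  have harctan : Tendsto (fun r => 2 * Real.arctan (r / c)) atTop (𝓝 (2 * (Real.pi / 2))) :=
    ((Real.tendsto_arctan_atTop.mono_right nhdsWithin_le_nhds).comp
      (tendsto_id.atTop_div_const hc)).const_mul 2
  rw [mul_div_cancel₀ _ two_ne_zero] at harctan
  exact ((Complex.continuous_ofReal.tendsto _).comp harctan).congr fun r =>
    (bromwichKernel_zero hc.ne').symm

lemma tendsto_bromwichKernel_of_pos (hc : 0 < c) (hx : 0 < x) :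
    Tendsto (bromwichKernel c x) atTop (𝓝 (2 * Real.pi)) := by
  have symmetric_sum : Tendsto (fun r => bromwichKernel c x r + bromwichKernel c (-x) r
      - 2 * bromwichKernel c 0 r) atTop (𝓝 0) := by
    refine squeeze_zero_norm' (a := fun r => 8 * c * Real.exp (c * x) / r) ?_ ?_
    · filter_upwards [eventually_gt_atTop 0] with r hr using
        norm_bromwichKernel_add_neg_sub_le hc hx.le hr
    · exact tendsto_const_nhds.div_atTop tendsto_id
  have := (symmetric_sum.sub (tendsto_bromwichKernel_of_neg hc (neg_lt_zero.mpr hx))).add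
    ((tendsto_bromwichKernel_zero hc).const_mul 2)
  rw [sub_zero, zero_add] at this
  exact this.congr fun r => by ring

lemma integrable_prod_exp_line_div {Ω : Type*} [MeasurableSpace Ω] {μ : Measure Ω}
    {Y : Ω → ℝ} (hY : Measurable Y) (hc : 0 < c)
    (hint : Integrable (fun ω => Real.exp (c * Y ω)) μ) (r : ℝ) :
    Integrable (Function.uncurry fun (y : ℝ) (ω : Ω) =>
      Complex.exp ((c + y * I) * Y ω) / (c + y * I))
      ((volume.restrict (Set.uIoc (-r) r)).prod μ) := by
  have : IsFiniteMeasure (volume.restrict (Set.uIoc (-r) r)) := ⟨by simp [Set.uIoc]⟩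
  have dominating : Integrable (fun z : ℝ × Ω => (1 / c : ℝ) * Real.exp (c * Y z.2))
      ((volume.restrict (Set.uIoc (-r) r)).prod μ) :=
    Integrable.mul_prod (f := fun _ : ℝ => (1 / c : ℝ)) (integrable_const _) hint
  refine dominating.mono' (Measurable.aestronglyMeasurable ?_) (.of_forall fun z =>
    (norm_exp_line_div_le_re hc (Y z.2) z.1).trans_eq (by ring))
  simp only [Function.uncurry_def]
  fun_prop

lemma tendsto_integral_bromwichKernel {Ω : Type*} [MeasurableSpace Ω] {μ : Measure Ω} [SFinite μ]
    {Y : Ω → ℝ} (hY : Measurable Y) (hY₀ : ∀ᵐ ω ∂μ, Y ω ≠ 0) (hc : 0 < c)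
    (hint : Integrable (fun ω => Real.exp (c * Y ω)) μ) :
    Tendsto (fun r => ∫ ω, bromwichKernel c (Y ω) r ∂μ) atTop
      (𝓝 (2 * Real.pi * μ.real {ω | 0 < Y ω})) := by
  have limit_eq : (2 * Real.pi * μ.real {ω | 0 < Y ω} : ℂ)
      = ∫ ω, {ω | 0 < Y ω}.indicator (fun _ => (2 * Real.pi : ℂ)) ω ∂μ := by
    rw [integral_indicator_const _ (measurableSet_lt measurable_const hY), Complex.real_smul,
      mul_comm]
  rw [limit_eq]
  refine tendsto_integral_filter_of_dominated_convergence
    (fun ω => (4 + 2 * Real.pi + 8 * c) * Real.exp (c * Y ω)) ?_ ?_ (hint.const_mul _) ?_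
  · filter_upwards [eventually_ge_atTop 0] with r hr
    have := (integrable_prod_exp_line_div hY hc hint r).integral_prod_right.aestronglyMeasurable
    simp only [bromwichKernel, intervalIntegral.integral_of_le (by linarith : -r ≤ r)]
    simpa [Set.uIoc_of_le (by linarith : -r ≤ r)] using this
  · filter_upwards [eventually_ge_atTop 1] with r hr
    exact .of_forall fun ω => norm_bromwichKernel_le hc hr (Y ω)
  · filter_upwards [hY₀] with ω hω
    rcases hω.lt_or_gt with hneg | hpos
    · rw [Set.indicator_of_notMem (by simpa using hneg.le)]
      exact tendsto_bromwichKernel_of_neg hc hneg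
    · rw [Set.indicator_of_mem (by simpa using hpos)]
      exact tendsto_bromwichKernel_of_pos hc hpos

theorem hasInverseLaplaceAt_complexMGF {Ω : Type*} [MeasurableSpace Ω] {μ : Measure Ω} [SFinite μ]
    {Y : Ω → ℝ} (hY : Measurable Y) {t : ℝ} (hYt : ∀ᵐ ω ∂μ, Y ω + t ≠ 0) (hc : 0 < c)
    (hint : Integrable (fun ω => Real.exp (c * Y ω)) μ) :
    HasInverseLaplaceAt (fun s => 1 / s * complexMGF Y μ s) c t (μ.real {ω | 0 < Y ω + t}) := by
  have hint_shift : Integrable (fun ω => Real.exp (c * (Y ω + t))) μ := by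
    simpa only [mul_add, Real.exp_add] using hint.mul_const (Real.exp (c * t))
  have integrable_prod := integrable_prod_exp_line_div (hY.add_const t) hc hint_shift
  have integrand_eq (y : ℝ) :
      Complex.exp ((c + y * I) * t) * (1 / (c + y * I) * complexMGF Y μ (c + y * I))
        = ∫ ω, Complex.exp ((c + y * I) * (Y ω + t : ℝ)) / (c + y * I) ∂μ := by
    rw [complexMGF, ← mul_assoc, ← integral_const_mul]
    congr 1 with ω
    rw [Complex.ofReal_add, mul_add, Complex.exp_add]
    ring
  simp only [HasInverseLaplaceAt, integrand_eq]
  refine ⟨fun r => intervalIntegrable_iff.mpr (integrable_prod r).integral_prod_left, ?_⟩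
  have fubini (r : ℝ) : ∫ y in (-r)..r, ∫ ω, Complex.exp ((c + y * I) * (Y ω + t : ℝ)) /
      (c + y * I) ∂μ = ∫ ω, bromwichKernel c (Y ω + t) r ∂μ :=
    intervalIntegral_integral_swap (integrable_prod r)
  simp only [fubini]
  convert! (tendsto_integral_bromwichKernel (hY.add_const t) hYt hc hint_shift).const_mul
    (1 / (2 * Real.pi) : ℂ) using 2
  have : (Real.pi : ℂ) ≠ 0 := mod_cast Real.pi_ne_zero
  field_simp

lemma HasInverseLaplaceAt.congr {F G : ℂ → ℂ} {t : ℝ} {v : ℂ} (h : HasInverseLaplaceAt F c t v)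
    (hFG : ∀ s : ℂ, s.re = c → F s = G s) : HasInverseLaplaceAt G c t v := by
  have hline (y : ℝ) : G (c + y * I) = F (c + y * I) := (hFG _ (by simp)).symm
  simpa only [HasInverseLaplaceAt, hline] using h

end Bromwich

/-! ### First times -/

lemma firstTime_lt_iff {A : ℝ≥0 → Prop} {x : ℝ≥0∞} :
    firstTime A < x ↔ ∃ t : ℝ≥0, A t ∧ (t : ℝ≥0∞) < x := by
  simp [firstTime, iInf_lt_iff]

lemma firstTime_le {A : ℝ≥0 → Prop} {t : ℝ≥0} (h : A t) : firstTime A ≤ t :=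
  iInf₂_le t h

lemma not_of_lt_firstTime {A : ℝ≥0 → Prop} {t : ℝ≥0} (h : (t : ℝ≥0∞) < firstTime A) : ¬ A t :=
  fun hA => (firstTime_le hA).not_gt h

lemma lt_firstTime {A : ℝ≥0 → Prop} {t : ℝ≥0} (right : ∀ᶠ u in 𝓝[>] t, ¬ A u)
    (upto : ∀ u ≤ t, ¬ A u) : (t : ℝ≥0∞) < firstTime A := by
  obtain ⟨v, hv, hA⟩ := (mem_nhdsGT_iff_exists_Ioo_subset).1 right
  refine (ENNReal.coe_lt_coe.2 (Set.mem_Ioi.1 hv)).trans_le (le_iInf₂ fun u hu => ?_)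
  by_contra! huv
  rcases le_or_gt u t with hut | htu
  · exact upto u hut hu
  · exact hA ⟨htu, ENNReal.coe_lt_coe.1 huv⟩ hu

lemma of_firstTime_eq {α : Type*} {f : ℝ≥0 → α} {p : α → Prop} {t : ℝ≥0}
    (hf : ∀ᶠ u in 𝓝[>] t, f u = f t) (h : firstTime (fun u => p (f u)) = t) : p (f t) := by
  by_contra hp
  refine (lt_firstTime (hf.mono fun u hu => hu ▸ hp) fun u hu => ?_).ne' h
  rcases hu.lt_or_eq with hlt | rfl
  · exact not_of_lt_firstTime (h ▸ ENNReal.coe_lt_coe.2 hlt)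
  · exact hp

lemma measurable_firstTime_mem {Ω E : Type*} {_ : MeasurableSpace Ω} [MeasurableSpace E]
    {Z : ℝ≥0 → Ω → E} (hZ : ∀ t, Measurable (Z t)) (hr : ∀ ω t, ∀ᶠ u in 𝓝[>] t, Z u ω = Z t ω)
    {S : Set E} (hS : MeasurableSet S) : Measurable fun ω => firstTime fun t => Z t ω ∈ S := by
  refine measurable_of_Iio fun x => ?_
  obtain ⟨D, hDc, hDd⟩ := TopologicalSpace.exists_countable_dense ℝ≥0
  have preimage_eq : (fun ω => firstTime fun t => Z t ω ∈ S) ⁻¹' Set.Iio x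
      = ⋃ t ∈ D ∩ {t : ℝ≥0 | (t : ℝ≥0∞) < x}, Z t ⁻¹' S := by
    ext ω
    simp only [Set.mem_preimage, Set.mem_Iio, firstTime_lt_iff, Set.mem_iUnion, exists_prop,
      Set.mem_inter_iff, Set.mem_ofPred_eq]
    constructor
    · rintro ⟨t, ht, htx⟩
      have before_x : ∀ᶠ u : ℝ≥0 in 𝓝[>] t, (u : ℝ≥0∞) < x :=
        (ENNReal.continuous_coe.continuousAt.eventually_lt_const htx).filter_mono
          nhdsWithin_le_nhds
      obtain ⟨v, hv, hsub⟩ := (mem_nhdsGT_iff_exists_Ioo_subset).1 ((hr ω t).and before_x)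
      obtain ⟨u, huD, hu⟩ := hDd.exists_between (Set.mem_Ioi.1 hv)
      obtain ⟨hut, hux⟩ := hsub hu
      exact ⟨u, ⟨huD, hux⟩, hut ▸ ht⟩
    · rintro ⟨t, ⟨_, htx⟩, ht⟩
      exact ⟨t, ht, htx⟩
  rw [preimage_eq]
  exact MeasurableSet.biUnion (hDc.mono Set.inter_subset_left) fun t _ => hZ t hS

section RandomTimes

variable {Ω : Type*} [MeasurableSpace Ω] {P : Measure Ω}

lemma IsMarkovJumpProcess.measurable_passageTime {Z : ℝ≥0 → Ω → ℕ} {x₀ : ℕ} {q : ℕ → ℕ → ℝ}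
    (hZ : IsMarkovJumpProcess P Z x₀ q) : Measurable (passageTime Z) :=
  measurable_firstTime_mem hZ.measurable hZ.right_continuous (measurableSet_singleton 0)

/-! ### Absence of atoms -/

lemma measure_eventually_mem_eq_zero [IsFiniteMeasure P] {ι : Type*} {l : Filter ι} [l.NeBot]
    [l.IsCountablyGenerated] {A : ι → Set Ω} (hA : Tendsto (fun i => P.real (A i)) l (𝓝 0)) :
    P {ω | ∀ᶠ i in l, ω ∈ A i} = 0 := by
  obtain ⟨x, hx⟩ := l.exists_seq_tendsto
  have subset : {ω | ∀ᶠ i in l, ω ∈ A i} ⊆ ⋃ K, {ω | ∀ k ≥ K, ω ∈ A (x k)} := fun ω hω =>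
    Set.mem_iUnion.2 (eventually_atTop.1 (hx.eventually hω))
  refine measure_mono_null subset (measure_iUnion_null fun K => ?_)
  refine (measureReal_eq_zero_iff).1 (le_antisymm ?_ measureReal_nonneg)
  exact ge_of_tendsto (hA.comp hx) (eventually_atTop.2 ⟨K, fun k hk =>
    measureReal_mono fun ω hω => hω k hk⟩)

lemma IsTransitionFunction.tendsto_off_diagonal {p : ℝ≥0 → ℕ → ℕ → ℝ} {q : ℕ → ℕ → ℝ}
    (hp : IsTransitionFunction p q) {x y : ℕ} (hxy : x ≠ y) :
    Tendsto (fun h => p h x y) (𝓝[>] 0) (𝓝 0) := by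
  have hcoe : Tendsto (fun h : ℝ≥0 => (h : ℝ)) (𝓝[>] 0) (𝓝 0) :=
    (NNReal.continuous_coe.tendsto' 0 0 rfl).mono_left nhdsWithin_le_nhds
  refine (mul_zero (q x y) ▸ (hp.deriv_zero x y).mul hcoe).congr' ?_
  filter_upwards [self_mem_nhdsWithin] with h hh
  rw [hp.zero, if_neg hxy, sub_zero, div_mul_cancel₀ _ (NNReal.coe_ne_zero.2 (ne_of_gt hh))]

lemma IsMarkovJumpProcess.tendsto_measureReal_jump [IsFiniteMeasure P] {Z : ℝ≥0 → Ω → ℕ} {x₀ : ℕ}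
    {q : ℕ → ℕ → ℝ} (hZ : IsMarkovJumpProcess P Z x₀ q) (t : ℝ≥0) {x y : ℕ} (hxy : x ≠ y) :
    Tendsto (fun s => P.real {ω | Z s ω = x ∧ Z t ω = y}) (𝓝[<] t) (𝓝 0) := by
  obtain ⟨p, hp, markov⟩ := hZ.markov
  have hsub : Tendsto (fun s => t - s) (𝓝[<] t) (𝓝[>] 0) := by
    refine tendsto_nhdsWithin_iff.2 ⟨?_, ?_⟩
    · exact (tsub_self t ▸ tendsto_const_nhds.sub tendsto_id).mono_left nhdsWithin_le_nhds
    · filter_upwards [self_mem_nhdsWithin] with s (hs : s < t) using tsub_pos_of_lt hs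
  have bound_tendsto : Tendsto (fun s => P.real Set.univ * p (t - s) x y) (𝓝[<] t) (𝓝 0) := by
    simpa using ((hp.tendsto_off_diagonal hxy).comp hsub).const_mul (P.real Set.univ)
  refine squeeze_zero' (.of_forall fun _ => measureReal_nonneg) ?_ bound_tendsto
  filter_upwards [self_mem_nhdsWithin] with s (hs : s < t)
  have jump := markov s (t - s) x y Set.univ MeasurableSet.univ
  rw [add_tsub_cancel_of_le hs.le, Set.univ_inter] at jump
  calc P.real {ω | Z s ω = x ∧ Z t ω = y} = P.real {ω | Z s ω = x} * p (t - s) x y := jump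
    _ ≤ P.real Set.univ * p (t - s) x y :=
      mul_le_mul_of_nonneg_right (measureReal_mono (Set.subset_univ _)) (hp.nonneg _ _ _)

lemma IsMarkovJumpProcess.measure_left_limit_eq [IsFiniteMeasure P] {Z : ℝ≥0 → Ω → ℕ} {x₀ : ℕ}
    {q : ℕ → ℕ → ℝ} (hZ : IsMarkovJumpProcess P Z x₀ q) {t : ℝ≥0} (ht : 0 < t) {x y : ℕ}
    (hxy : x ≠ y) : P {ω | (∀ᶠ u in 𝓝[<] t, Z u ω = x) ∧ Z t ω = y} = 0 := by
  have : (𝓝[<] t).NeBot := nhdsLT_neBot_of_exists_lt ⟨0, ht⟩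
  refine measure_mono_null ?_ (measure_eventually_mem_eq_zero (hZ.tendsto_measureReal_jump t hxy))
  rintro ω ⟨hx, hy⟩
  exact hx.mono fun u hu => ⟨hu, hy⟩

lemma IsMarkovJumpProcess.measure_passageTime_eq [IsFiniteMeasure P] {Z : ℝ≥0 → Ω → ℕ} {x₀ : ℕ}
    {q : ℕ → ℕ → ℝ} (hZ : IsMarkovJumpProcess P Z x₀ q) (hx₀ : x₀ ≠ 0) (t : ℝ≥0) :
    P {ω | passageTime Z ω = t} = 0 := by
  have zero_at (ω : Ω) (h : passageTime Z ω = t) : Z t ω = 0 :=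
    of_firstTime_eq (f := fun t => Z t ω) (p := (· = 0)) (hZ.right_continuous ω t) h
  rcases eq_zero_or_pos t with rfl | ht
  · refine measure_mono_null (fun ω h => ?_) (ae_iff.1 hZ.start)
    change ¬ Z 0 ω = x₀
    rw [zero_at ω h]
    exact hx₀.symm
  · have subset : {ω | passageTime Z ω = t}
        ⊆ ⋃ x : {x : ℕ // x ≠ 0}, {ω | (∀ᶠ u in 𝓝[<] t, Z u ω = x) ∧ Z t ω = 0} := by
      intro ω (h : passageTime Z ω = t)
      obtain ⟨x, hx⟩ := hZ.left_limit ω t ht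
      have : (𝓝[<] t).NeBot := nhdsLT_neBot_of_exists_lt ⟨0, ht⟩
      obtain ⟨u, hu, hut⟩ := (hx.and self_mem_nhdsWithin).exists
      have hZu : Z u ω ≠ 0 := not_of_lt_firstTime (A := fun t => Z t ω = 0)
        ((ENNReal.coe_lt_coe.2 hut).trans_eq h.symm)
      exact Set.mem_iUnion.2 ⟨⟨x, hu ▸ hZu⟩, hx, zero_at ω h⟩
    exact measure_mono_null subset (measure_iUnion_null fun x => hZ.measure_left_limit_eq ht x.2)

lemma IsExponentialTime.measure_eq [IsProbabilityMeasure P] {T : Ω → ℝ≥0∞} {rate : ℝ≥0}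
    (hT : IsExponentialTime P T rate) (t : ℝ≥0) : P {ω | T ω = t} = 0 := by
  have measurable_lt (s : ℝ≥0) : MeasurableSet {ω | (s : ℝ≥0∞) < T ω} :=
    measurableSet_lt measurable_const hT.measurable
  rcases eq_zero_or_pos t with rfl | ht
  · have compl_null := probReal_compl_eq_one_sub (μ := P) (measurable_lt 0)
    rw [hT.tail 0, NNReal.coe_zero, mul_zero, neg_zero, Real.exp_zero, sub_self,
      measureReal_eq_zero_iff] at compl_null
    exact measure_mono_null (fun ω (hω : T ω = (0 : ℝ≥0)) => by simp [hω]) compl_null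
  · have : (𝓝[<] t).NeBot := nhdsLT_neBot_of_exists_lt ⟨0, ht⟩
    have window : Tendsto (fun s : ℝ≥0 => P.real ({ω | (s : ℝ≥0∞) < T ω} \ {ω | (t : ℝ≥0∞) < T ω}))
        (𝓝[<] t) (𝓝 0) := by
      have tail_sub : Tendsto (fun s : ℝ≥0 => Real.exp (-(rate * s)) - Real.exp (-(rate * t)))
          (𝓝[<] t) (𝓝 0) := by
        have continuous_tail : Continuous fun s : ℝ≥0 =>
            Real.exp (-(rate * s)) - Real.exp (-(rate * t)) := by fun_prop
        exact (continuous_tail.tendsto' t 0 (sub_self _)).mono_left nhdsWithin_le_nhds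
      refine tail_sub.congr' ?_
      filter_upwards [self_mem_nhdsWithin] with s (hs : s < t)
      have nested : {ω | (t : ℝ≥0∞) < T ω} ⊆ {ω | (s : ℝ≥0∞) < T ω} := fun ω =>
        (ENNReal.coe_lt_coe.2 hs).trans
      rw [measureReal_sdiff nested (measurable_lt t), hT.tail, hT.tail]
    refine measure_mono_null (fun ω (hω : T ω = t) => ?_) (measure_eventually_mem_eq_zero window)
    filter_upwards [self_mem_nhdsWithin] with s (hs : s < t)
    simpa [hω] using hs

lemma ae_ne_of_indepFun [IsFiniteMeasure P] {S T : Ω → ℝ≥0∞} (hS : Measurable S)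
    (hT : Measurable T) (hST : IndepFun S T P) (h : ∀ t : ℝ≥0, P {ω | S ω = t} = 0) :
    ∀ᵐ ω ∂P, S ω ≠ ∞ → S ω ≠ T ω := by
  have measurable_tie : MeasurableSet {z : ℝ≥0∞ × ℝ≥0∞ | z.2 ≠ ∞ ∧ z.2 = z.1} :=
    ((measurableSet_singleton ∞).compl.preimage measurable_snd).inter
      (measurableSet_eq_fun measurable_snd measurable_fst)
  have tie_null : (P.map T).prod (P.map S) {z : ℝ≥0∞ × ℝ≥0∞ | z.2 ≠ ∞ ∧ z.2 = z.1} = 0 := by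
    refine (Measure.measure_prod_null measurable_tie).2 (.of_forall fun x => ?_)
    change P.map S (Prod.mk x ⁻¹' _) = 0
    rw [Measure.map_apply hS (measurable_prodMk_left measurable_tie)]
    induction x with
    | top => exact measure_mono_null (fun ω hω => hω.1 hω.2) measure_empty
    | coe x => exact measure_mono_null (fun ω hω => hω.2) (h x)
  rw [← (indepFun_iff_map_prod_eq_prod_map_map hT.aemeasurable hS.aemeasurable).1 hST.symm,
    Measure.map_apply (hT.prodMk hS) measurable_tie] at tie_null
  exact ae_iff.2 (measure_mono_null (fun ω hω => by simpa using hω) tie_null)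

/-! ### Minima of independent times -/

lemma indepFun_iInf_comp {ι κ : Type*} [Finite κ] {Y : ι → Ω → ℝ≥0∞} (hY : iIndepFun Y P)
    (hm : ∀ d, Measurable (Y d)) {g : κ → ι} {d : ι} (hd : ∀ k, g k ≠ d) :
    IndepFun (Y d) (fun ω => ⨅ k, Y (g k) ω) P := by
  classical
  have := Fintype.ofFinite κ
  have indep := hY.indepFun_finset {d} (Finset.univ.image g) (by simpa using hd) hm
  have hφ : Measurable fun v : ({d} : Finset ι) → ℝ≥0∞ => v ⟨d, by simp⟩ := measurable_pi_apply _
  have hψ : Measurable fun v : Finset.univ.image g → ℝ≥0∞ => ⨅ k, v ⟨g k, by simp⟩ :=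
    .iInf fun k => measurable_pi_apply _
  exact indep.comp hφ hψ

lemma measureReal_lt_iInf {κ : Type*} [Fintype κ] {Y : κ → Ω → ℝ≥0∞} (hY : iIndepFun Y P)
    {t : ℝ≥0∞} (ht : t < ∞) : P.real {ω | t < ⨅ k, Y k ω} = ∏ k, P.real {ω | t < Y k ω} := by
  have inter_eq : {ω | t < ⨅ k, Y k ω} = ⋂ k ∈ Finset.univ, Y k ⁻¹' Set.Ioi t := by
    ext ω
    simp [← Finset.inf_univ_eq_iInf, Finset.lt_inf_iff ht]
  rw [inter_eq, measureReal_def, hY.measure_inter_preimage_eq_mul Finset.univ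
    (sets := fun _ => Set.Ioi t) fun _ _ => measurableSet_Ioi, ENNReal.toReal_prod]
  rfl

/-! ### Survival functions and Laplace transforms -/

/-- The survival function of a random time. -/
noncomputable def survival (P : Measure Ω) (Y : Ω → ℝ≥0∞) (t : ℝ) : ℝ :=
  P.real {ω | ENNReal.ofReal t < Y ω}

/-- The exponential of `z y`, cut off to `0` at `y = ∞` as in the definition of `laplace`. -/
noncomputable def finiteExp (z : ℂ) : ℝ≥0∞ → ℂ :=
  {y | y < ∞}.indicator fun y => Complex.exp (z * y.toReal)

/-- The exponential `t ↦ exp (z t)` killed at time `y`. Its integral over `t > 0` is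
`(finiteExp z y - 1) / z`, and its mean over the law of `y` is `exp (z t)` times the survival
function. -/
noncomputable def killedExp (z : ℂ) (y : ℝ≥0∞) : ℝ → ℂ :=
  {t | ENNReal.ofReal t < y}.indicator fun t => Complex.exp (z * t)

lemma measurable_finiteExp (z : ℂ) : Measurable (finiteExp z) :=
  Measurable.indicator (by fun_prop) measurableSet_Iio

lemma laplace_eq_integral_finiteExp {Y : Ω → ℝ≥0∞} (hY : Measurable Y) (s : ℂ) :
    laplace P Y s = ∫ ω, finiteExp (-s) (Y ω) ∂P :=
  (integral_indicator (measurableSet_lt hY measurable_const)).symm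

lemma norm_finiteExp_ofReal {y : ℝ≥0∞} (hy : y < ∞) (κ : ℝ) :
    ‖finiteExp κ y‖ = Real.exp (κ * y.toReal) := by
  rw [finiteExp, Set.indicator_of_mem (by exact hy), ← Complex.ofReal_mul, Complex.norm_exp_ofReal]

lemma survival_nonneg (Y : Ω → ℝ≥0∞) (t : ℝ) : 0 ≤ survival P Y t :=
  measureReal_nonneg

lemma antitone_survival [IsFiniteMeasure P] (Y : Ω → ℝ≥0∞) : Antitone (survival P Y) :=
  fun _ _ hst => measureReal_mono fun _ => (ENNReal.ofReal_le_ofReal hst).trans_lt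

lemma norm_killedExp (z : ℂ) (y : ℝ≥0∞) (t : ℝ) :
    ‖killedExp z y t‖ = {t | ENNReal.ofReal t < y}.indicator (fun t => Real.exp (z.re * t)) t := by
  rw [killedExp, norm_indicator_eq_indicator_norm]
  simp [Set.indicator_apply, Complex.norm_exp]

lemma measurable_killedExp {Y : Ω → ℝ≥0∞} (hY : Measurable Y) (z : ℂ) :
    Measurable (Function.uncurry fun ω t => killedExp z (Y ω) t) :=
  Measurable.indicator (f := fun w : Ω × ℝ => Complex.exp (z * w.2))
    (s := {w | ENNReal.ofReal w.2 < Y w.1}) (by fun_prop)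
    (measurableSet_lt (by fun_prop) (by fun_prop))

lemma setIntegral_indicator_ofReal_lt {E : Type*} [NormedAddCommGroup E] [NormedSpace ℝ E]
    (f : ℝ → E) {y : ℝ≥0∞} (hy : y < ∞) :
    ∫ t in Set.Ioi (0 : ℝ), {t | ENNReal.ofReal t < y}.indicator f t
      = ∫ t in (0 : ℝ)..y.toReal, f t := by
  rw [setIntegral_indicator (measurableSet_lt ENNReal.measurable_ofReal measurable_const),
    intervalIntegral.integral_of_le ENNReal.toReal_nonneg, integral_Ioc_eq_integral_Ioo]
  congr 2
  ext t
  exact and_congr_right fun ht => ENNReal.ofReal_lt_iff_lt_toReal (le_of_lt ht) hy.ne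

lemma integral_killedExp {z : ℂ} (hz : z ≠ 0) {y : ℝ≥0∞} (hy : y < ∞ ∨ z.re < 0) :
    ∫ t in Set.Ioi (0 : ℝ), killedExp z y t = (finiteExp z y - 1) / z := by
  rcases lt_or_eq_of_le (le_top : y ≤ ∞) with hfin | rfl
  · simp only [killedExp, finiteExp]
    rw [setIntegral_indicator_ofReal_lt _ hfin, integral_exp_mul_complex hz,
      Set.indicator_of_mem (by exact hfin)]
    simp
  · have hre : z.re < 0 := hy.resolve_left (lt_irrefl _)
    simp only [killedExp, finiteExp, ENNReal.ofReal_lt_top, Set.ofPred_true, Set.indicator_univ]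
    rw [integral_exp_mul_complex_Ioi hre 0, Set.indicator_of_notMem (by simp)]
    simp

lemma integral_norm_killedExp_ofReal {κ : ℝ} (hκ : κ ≠ 0) {y : ℝ≥0∞} (hy : y < ∞) :
    ∫ t in Set.Ioi (0 : ℝ), ‖killedExp κ y t‖ = (Real.exp (κ * y.toReal) - 1) / κ := by
  simp only [norm_killedExp, Complex.ofReal_re]
  rw [setIntegral_indicator_ofReal_lt _ hy,
    intervalIntegral.integral_comp_mul_left (fun t => Real.exp t) hκ, integral_exp]
  simp [div_eq_inv_mul]

lemma integrableOn_killedExp {z : ℂ} {y : ℝ≥0∞} (hy : y < ∞) :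
    IntegrableOn (killedExp z y) (Set.Ioi 0) := by
  have measurable_alive : MeasurableSet {t : ℝ | ENNReal.ofReal t < y} :=
    measurableSet_lt ENNReal.measurable_ofReal measurable_const
  rw [killedExp, IntegrableOn, integrable_indicator_iff measurable_alive, IntegrableOn,
    Measure.restrict_restrict measurable_alive]
  refine IntegrableOn.mono_set (t := Set.Icc 0 y.toReal)
    (Continuous.integrableOn_Icc (by fun_prop)) ?_
  rintro t ⟨hty, ht : 0 < t⟩
  exact ⟨ht.le, ((ENNReal.ofReal_lt_iff_lt_toReal ht.le hy.ne).1 hty).le⟩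

lemma integral_killedExp_comp {Y : Ω → ℝ≥0∞} (hY : Measurable Y) (z : ℂ) (t : ℝ) :
    ∫ ω, killedExp z (Y ω) t ∂P = Complex.exp (z * t) * survival P Y t := by
  have survivors : (fun ω => killedExp z (Y ω) t)
      = {ω | ENNReal.ofReal t < Y ω}.indicator fun _ => Complex.exp (z * t) := rfl
  rw [survivors, integral_indicator_const _ (measurableSet_lt measurable_const hY),
    Complex.real_smul, mul_comm, survival]

lemma integral_norm_killedExp_comp {Y : Ω → ℝ≥0∞} (hY : Measurable Y) (z : ℂ) (t : ℝ) :
    ∫ ω, ‖killedExp z (Y ω) t‖ ∂P = Real.exp (z.re * t) * survival P Y t := by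
  have survivors : (fun ω => ‖killedExp z (Y ω) t‖)
      = {ω | ENNReal.ofReal t < Y ω}.indicator fun _ => Real.exp (z.re * t) :=
    funext fun ω => norm_killedExp z (Y ω) t
  rw [survivors, integral_indicator_const _ (measurableSet_lt measurable_const hY), smul_eq_mul,
    mul_comm, survival]

section Finite

variable [IsFiniteMeasure P] {Y : Ω → ℝ≥0∞}

lemma integrable_killedExp_iff (hY : Measurable Y) {z : ℂ} :
    Integrable (Function.uncurry fun ω t => killedExp z (Y ω) t)
        (P.prod (volume.restrict (Set.Ioi 0))) ↔
      IntegrableOn (fun t => Real.exp (z.re * t) * survival P Y t) (Set.Ioi 0) := by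
  have hm := measurable_killedExp hY z
  rw [integrable_prod_iff' hm.aestronglyMeasurable]
  simp only [Function.uncurry_apply_pair, integral_norm_killedExp_comp hY]
  refine and_iff_right (.of_forall fun t => ?_)
  refine Integrable.of_bound (C := Real.exp (z.re * t))
    (hm.comp (measurable_id.prodMk measurable_const)).aestronglyMeasurable (.of_forall fun ω => ?_)
  rw [norm_killedExp]
  exact Set.indicator_le_self' (fun _ _ => (Real.exp_pos _).le) t

lemma integrableOn_survival_of_neg {κ : ℝ} (hκ : κ < 0) :
    IntegrableOn (fun t => Real.exp (κ * t) * survival P Y t) (Set.Ioi 0) := by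
  refine ((integrableOn_exp_mul_Ioi hκ 0).mul_const (P.real Set.univ)).mono'
    (Measurable.mul (by fun_prop) (antitone_survival Y).measurable).aestronglyMeasurable
    (.of_forall fun t => ?_)
  rw [Real.norm_of_nonneg (mul_nonneg (Real.exp_pos _).le (survival_nonneg Y t))]
  exact mul_le_mul_of_nonneg_left (measureReal_mono (Set.subset_univ _)) (Real.exp_pos _).le

lemma integrableOn_survival_of_integrable_exp (hY : Measurable Y) {κ : ℝ} (hκ : κ ≠ 0)
    (hfin : ∀ᵐ ω ∂P, Y ω < ∞) (hexp : Integrable (fun ω => Real.exp (κ * (Y ω).toReal)) P) :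
    IntegrableOn (fun t => Real.exp (κ * t) * survival P Y t) (Set.Ioi 0) := by
  rw [← Complex.ofReal_re κ, ← integrable_killedExp_iff hY,
    integrable_prod_iff (measurable_killedExp hY _).aestronglyMeasurable]
  refine ⟨hfin.mono fun ω hω => integrableOn_killedExp hω, ?_⟩
  refine ((hexp.sub (integrable_const 1)).div_const κ).congr (hfin.mono fun ω hω => ?_)
  exact (integral_norm_killedExp_ofReal hκ hω).symm

lemma ae_lt_top_of_integrableOn_survival {κ : ℝ} (hκ : 0 ≤ κ)
    (h : IntegrableOn (fun t => Real.exp (κ * t) * survival P Y t) (Set.Ioi 0)) :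
    ∀ᵐ ω ∂P, Y ω < ∞ := by
  have integrable_const : IntegrableOn (fun _ : ℝ => P.real {ω | Y ω = ∞}) (Set.Ioi 0) := by
    refine h.mono' aestronglyMeasurable_const ?_
    filter_upwards [ae_restrict_mem measurableSet_Ioi] with t (ht : 0 < t)
    rw [Real.norm_of_nonneg measureReal_nonneg]
    calc P.real {ω | Y ω = ∞} ≤ survival P Y t :=
          measureReal_mono fun ω (hω : Y ω = ∞) => by simp [hω]
      _ ≤ Real.exp (κ * t) * survival P Y t :=
          le_mul_of_one_le_left (survival_nonneg Y t) (Real.one_le_exp (by positivity))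
  have null : P.real {ω | Y ω = ∞} = 0 := by
    simpa [integrableOn_const_iff] using integrable_const
  simpa [ae_iff] using (measureReal_eq_zero_iff (by finiteness)).1 null

section SurvivalIntegrable

variable {z : ℂ} (hY : Measurable Y) (hz : z ≠ 0)
  (h : IntegrableOn (fun t => Real.exp (z.re * t) * survival P Y t) (Set.Ioi 0))

include hz h

lemma ae_integral_killedExp :
    ∀ᵐ ω ∂P, ∫ t in Set.Ioi (0 : ℝ), killedExp z (Y ω) t = (finiteExp z (Y ω) - 1) / z := by
  rcases lt_or_ge z.re 0 with hre | hre
  · exact .of_forall fun ω => integral_killedExp hz (.inr hre)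
  · exact (ae_lt_top_of_integrableOn_survival hre h).mono fun ω hω =>
      integral_killedExp hz (.inl hω)

include hY

lemma integrable_finiteExp : Integrable (fun ω => finiteExp z (Y ω)) P := by
  have integrable_sub := ((integrable_killedExp_iff hY).2 h).integral_prod_left.congr
    (ae_integral_killedExp hz h)
  refine ((integrable_sub.mul_const z).add (integrable_const 1)).congr (.of_forall fun ω => ?_)
  simp [div_mul_cancel₀ _ hz]

lemma laplace_neg_eq_add_integral_survival :
    laplace P Y (-z) = P.real Set.univ
      + z * ∫ t in Set.Ioi (0 : ℝ), Complex.exp (z * t) * survival P Y t := by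
  have swap := integral_integral_swap ((integrable_killedExp_iff hY).2 h)
  simp only [integral_killedExp_comp hY] at swap
  rw [← swap, integral_congr_ae (ae_integral_killedExp hz h), integral_div,
    integral_sub (integrable_finiteExp hY hz h) (integrable_const 1), mul_div_cancel₀ _ hz,
    laplace_eq_integral_finiteExp hY, neg_neg]
  simp

end SurvivalIntegrable

end Finite

section IndependentTimes

variable {ε σ M : Ω → ℝ≥0∞} {c θ : ℝ}

lemma integrableOn_survival_exp_tilt_iff
    (hMσ : ∀ t > 0, survival P M t = survival P σ t * Real.exp (-(θ * t))) :
    IntegrableOn (fun t => Real.exp (c * t) * survival P M t) (Set.Ioi 0) ↔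
      IntegrableOn (fun t => Real.exp ((c - θ) * t) * survival P σ t) (Set.Ioi 0) := by
  refine integrableOn_congr_fun (fun t ht => ?_) measurableSet_Ioi
  rw [hMσ t ht, mul_left_comm, ← Real.exp_add, mul_comm, sub_mul, sub_eq_add_neg]

lemma laplace_neg_of_survival_exp_tilt [IsProbabilityMeasure P] (hσ : Measurable σ)
    (hM : Measurable M) (hMσ : ∀ t > 0, survival P M t = survival P σ t * Real.exp (-(θ * t)))
    {s : ℂ} (hs : s ≠ 0) (hsθ : s ≠ θ)
    (hint : IntegrableOn (fun t => Real.exp ((s.re - θ) * t) * survival P σ t) (Set.Ioi 0)) :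
    laplace P M (-s)
      = laplace P σ (θ - s) + θ / (θ - s) * (1 - laplace P σ (θ - s)) := by
  have hsθ' : s - θ ≠ 0 := sub_ne_zero.2 hsθ
  have hθs : (θ - s : ℂ) ≠ 0 := sub_ne_zero.2 hsθ.symm
  have laplace_M := laplace_neg_eq_add_integral_survival hM hs
    ((integrableOn_survival_exp_tilt_iff hMσ).2 hint)
  have laplace_σ := laplace_neg_eq_add_integral_survival (P := P) hσ hsθ' (by simpa using hint)
  have same_integral : ∫ t in Set.Ioi (0 : ℝ), Complex.exp (s * t) * survival P M t
      = ∫ t in Set.Ioi (0 : ℝ), Complex.exp ((s - θ) * t) * survival P σ t := by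
    refine setIntegral_congr_fun measurableSet_Ioi fun t ht => ?_
    simp only [hMσ t ht, Complex.ofReal_mul, Complex.ofReal_exp]
    rw [mul_left_comm, ← Complex.exp_add, mul_comm]
    push_cast
    ring_nf
  rw [probReal_univ, Complex.ofReal_one] at laplace_M laplace_σ
  rw [neg_sub] at laplace_σ
  rw [laplace_M, same_integral, laplace_σ]
  field_simp
  ring

lemma laplace_mul_laplace_neg (hε : Measurable ε) (hM : Measurable M) (hind : IndepFun ε M P)
    (hMfin : ∀ᵐ ω ∂P, M ω < ∞) (s : ℂ) :
    laplace P ε s * laplace P M (-s)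
      = complexMGF (fun ω => (M ω).toReal - (ε ω).toReal) (P.restrict {ω | ε ω < ∞}) s := by
  have hind_exp := hind.comp (measurable_finiteExp (-s)) (measurable_finiteExp s)
  rw [laplace_eq_integral_finiteExp hε, laplace_eq_integral_finiteExp hM, neg_neg, complexMGF,
    ← integral_indicator (measurableSet_lt hε measurable_const)]
  refine (hind_exp.integral_fun_mul_eq_mul_integral
    ((measurable_finiteExp _).comp hε).aestronglyMeasurable
    ((measurable_finiteExp _).comp hM).aestronglyMeasurable).symm.trans (integral_congr_ae ?_)
  filter_upwards [hMfin] with ω hω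
  by_cases hεω : ε ω < ∞
  · simp only [finiteExp, Function.comp_apply, Set.indicator_apply, Set.mem_ofPred_eq, hεω, hω,
      if_true, ← Complex.exp_add]
    push_cast
    ring_nf
  · simp [finiteExp, Set.indicator_apply, hεω]

theorem hasInverseLaplaceAt_laplace_mul_laplace_neg [IsFiniteMeasure P] (hε : Measurable ε)
    (hM : Measurable M) (hind : IndepFun ε M P) (htie : ∀ᵐ ω ∂P, ε ω ≠ ∞ → ε ω ≠ M ω) (hc : 0 < c)
    (hint : IntegrableOn (fun t => Real.exp (c * t) * survival P M t) (Set.Ioi 0)) :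
    HasInverseLaplaceAt (fun s => 1 / s * (laplace P ε s * laplace P M (-s))) c 0
      (P.real {ω | ε ω < M ω}) := by
  have hMfin := ae_lt_top_of_integrableOn_survival hc.le hint
  have measurable_finite : MeasurableSet {ω | ε ω < ∞} := measurableSet_lt hε measurable_const
  have integrable_M : Integrable (fun ω => Real.exp (c * (M ω).toReal)) P :=
    (integrable_finiteExp hM (Complex.ofReal_ne_zero.2 hc.ne') hint).norm.congr
      (hMfin.mono fun ω hω => norm_finiteExp_ofReal hω c)
  have integrable_diff : Integrable (fun ω => Real.exp (c * ((M ω).toReal - (ε ω).toReal)))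
      (P.restrict {ω | ε ω < ∞}) := by
    refine integrable_M.restrict.mono' (by fun_prop) (.of_forall fun ω => ?_)
    rw [Real.norm_of_nonneg (Real.exp_pos _).le]
    gcongr
    exact sub_le_self _ ENNReal.toReal_nonneg
  have diff_ne_zero : ∀ᵐ ω ∂P.restrict {ω | ε ω < ∞}, (M ω).toReal - (ε ω).toReal + 0 ≠ 0 := by
    rw [ae_restrict_iff' measurable_finite]
    filter_upwards [htie, hMfin] with ω hne hMω (hεω : ε ω < ∞) heq
    rw [add_zero, sub_eq_zero, ENNReal.toReal_eq_toReal_iff' hMω.ne hεω.ne] at heq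
    exact hne hεω.ne heq.symm
  have inverse := (hasInverseLaplaceAt_complexMGF (by fun_prop) diff_ne_zero hc
    integrable_diff).congr fun s _ => by rw [← laplace_mul_laplace_neg hε hM hind hMfin]
  convert inverse using 2
  rw [measureReal_restrict_apply (measurableSet_lt measurable_const (by fun_prop))]
  refine measureReal_congr ?_
  filter_upwards [hMfin] with ω hMω
  refine propext ⟨fun h : ε ω < M ω => ⟨?_, h.trans hMω⟩, fun ⟨h, hεω⟩ => ?_⟩
  · simpa using (ENNReal.toReal_lt_toReal h.ne_top hMω.ne).2 h
  · exact (ENNReal.toReal_lt_toReal (ne_of_lt hεω) hMω.ne).1 (by simpa using h)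

theorem hasInverseLaplaceAt_fillTransform [IsProbabilityMeasure P] (hε : Measurable ε)
    (hσ : Measurable σ) (hM : Measurable M) (hind : IndepFun ε M P)
    (htie : ∀ᵐ ω ∂P, ε ω ≠ ∞ → ε ω ≠ M ω) {Λ : ℝ} (hc : 0 < c) (hcΛ : c ≠ 2 * Λ)
    (hMσ : ∀ t > 0, survival P M t = survival P σ t * Real.exp (-(2 * Λ * t)))
    (hint : IntegrableOn (fun t => Real.exp ((c - 2 * Λ) * t) * survival P σ t) (Set.Ioi 0)) :
    HasInverseLaplaceAt (fillTransform (laplace P ε) (laplace P σ) Λ) c 0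
      (P.real {ω | ε ω < M ω}) := by
  refine (hasInverseLaplaceAt_laplace_mul_laplace_neg hε hM hind htie hc
    ((integrableOn_survival_exp_tilt_iff hMσ).2 hint)).congr fun s hs => ?_
  have hs0 : s ≠ 0 := fun h => hc.ne' (by simpa [h] using hs.symm)
  have hsΛ : s ≠ (2 * Λ : ℝ) := fun h => hcΛ (by simpa [h] using hs.symm)
  rw [fillTransform, laplace_neg_of_survival_exp_tilt hσ hM hMσ hs0 hsΛ (hs ▸ hint), mul_assoc]
  push_cast
  rfl

end IndependentTimes

end RandomTimes

/-! ### Best quotes of a book -/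

instance : Fintype Side where
  elems := ⟨{.ask, .bid}, by simp⟩
  complete k := by cases k <;> simp

lemma Side.opp_opp (k : Side) : k.opp.opp = k := by cases k <;> rfl

lemma Side.sign_mul_self (k : Side) : k.sign * k.sign = 1 := by cases k <;> rfl

section Quotes

variable {N s₀ a b l : ℕ} {y : Book}

lemma bestAsk_le (hl : 1 ≤ l) (hlN : l ≤ N) (hy : 0 < y l) : bestAsk N y ≤ l :=
  Nat.sInf_le (.inl ⟨hl, hlN, hy⟩)

lemma le_bestAsk (hl : l ≤ N + 1) (hy : ∀ k < l, y k ≤ 0) : l ≤ bestAsk N y := by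
  refine le_csInf ⟨N + 1, .inr rfl⟩ ?_
  rintro k (⟨-, -, hk⟩ | rfl)
  · exact le_of_not_gt fun hkl => (hy k hkl).not_gt hk
  · exact hl

lemma le_bestBid (hl : 1 ≤ l) (hlN : l ≤ N) (hy : y l < 0) : l ≤ bestBid N y := by
  refine le_csSup ⟨N, ?_⟩ (.inl ⟨hl, hlN, hy⟩)
  rintro k (⟨-, hk, -⟩ | rfl)
  · exact hk
  · exact Nat.zero_le _

lemma bestBid_le (hy : ∀ k, l < k → 0 ≤ y k) : bestBid N y ≤ l := by
  refine csSup_le ⟨0, .inr rfl⟩ ?_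
  rintro k (⟨-, -, hk⟩ | rfl)
  · exact le_of_not_gt fun hlk => (hy k hlk).not_gt hk
  · exact Nat.zero_le _

lemma midPrice_congr {x : Book} (h : ∀ l ≤ N, x l = y l) : midPrice N x = midPrice N y := by
  have same_levels (p : ℤ → Prop) :
      {l | 1 ≤ l ∧ l ≤ N ∧ p (x l)} = {l | 1 ≤ l ∧ l ≤ N ∧ p (y l)} := by
    ext l
    exact and_congr_right fun _ => and_congr_right fun hl => by rw [h l hl]
  simp only [midPrice, bestAsk, bestBid, same_levels (0 < ·), same_levels (· < 0)]

lemma eventually_midPrice_eq {x : ℝ≥0 → Book} (hx : ∀ t l, ∀ᶠ u in 𝓝[>] t, x u l = x t l)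
    (t : ℝ≥0) : ∀ᶠ u in 𝓝[>] t, midPrice N (x u) = midPrice N (x t) :=
  (((Set.finite_Iic N).eventually_all (p := fun l u => x u l = x t l)).2 fun l _ => hx t l).mono
    fun _ hu => midPrice_congr hu

lemma midPrice_eq_of_quotes (h : ∀ k : Side, k.quote (bestAsk N y) (bestBid N y) = k.quote a b) :
    midPrice N y = ((b : ℝ) + a) / 2 := by
  have ask_eq : bestAsk N y = a := h .ask
  have bid_eq : bestBid N y = b := h .bid
  rw [midPrice, ask_eq, bid_eq]

lemma midPrice_ne_of_quotes {k : Side} (h : k.quote (bestAsk N y) (bestBid N y) ≠ k.quote a b)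
    (h' : k.opp.quote (bestAsk N y) (bestBid N y) = k.opp.quote a b) :
    midPrice N y ≠ ((b : ℝ) + a) / 2 := by
  rw [midPrice, ne_eq, div_left_inj' two_ne_zero]
  cases k <;> simp only [Side.quote, Side.opp] at h h' <;> norm_cast <;> omega

section Spread

variable (hab : a = b + (s₀ + 1))

include hab

lemma quote_ne_of_inside_pos (hb : 1 ≤ b) (ha : a ≤ N) {k : Side} {r : Fin s₀}
    (hinside : 0 < k.sign * y (k.insideLevel a b r)) :
    k.quote (bestAsk N y) (bestBid N y) ≠ k.quote a b := by
  have := r.2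
  cases k <;> simp only [Side.quote, Side.sign, Side.insideLevel, one_mul, neg_mul,
    Left.neg_pos_iff] at *
  · have := bestAsk_le (N := N) (by omega) (by omega) hinside
    omega
  · have := le_bestBid (N := N) (by omega) (by omega) hinside
    omega

lemma nonpos_of_lt_ask (hbid : ∀ l ≤ b, y l ≤ 0)
    (hinside : ∀ r : Fin s₀, ¬ 0 < Side.ask.sign * y (Side.ask.insideLevel a b r)) (hl : l < a) :
    y l ≤ 0 := by
  rcases le_or_gt l b with hlb | hbl
  · exact hbid l hlb
  · have := hinside ⟨a - l - 1, by omega⟩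
    rw [Side.insideLevel, show a - (a - l - 1 + 1) = l by omega] at this
    simpa [Side.sign] using this

lemma nonneg_of_bid_lt (hask : ∀ l, a ≤ l → 0 ≤ y l)
    (hinside : ∀ r : Fin s₀, ¬ 0 < Side.bid.sign * y (Side.bid.insideLevel a b r)) (hl : b < l) :
    0 ≤ y l := by
  rcases le_or_gt a l with hal | hla
  · exact hask l hal
  · have := hinside ⟨l - b - 1, by omega⟩
    rw [Side.insideLevel, show b + (l - b - 1 + 1) = l by omega] at this
    simpa [Side.sign] using this

variable {k : Side} (hb : 1 ≤ b) (ha : a ≤ N)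
  (hcross : ∀ l, (l ≤ b → y l ≤ 0) ∧ (a ≤ l → 0 ≤ y l))
  (hinside : ∀ r : Fin s₀, ¬ 0 < k.sign * y (k.insideLevel a b r))

include hb ha hcross hinside

lemma quote_eq_of_pos (hown : 0 < k.sign * y (k.quote a b)) :
    k.quote (bestAsk N y) (bestBid N y) = k.quote a b := by
  cases k <;> simp only [Side.quote, Side.sign, one_mul, neg_mul, Left.neg_pos_iff] at hown ⊢
  · exact le_antisymm (bestAsk_le (by omega) ha hown)
      (le_bestAsk (by omega) fun l => nonpos_of_lt_ask hab (fun l => (hcross l).1) hinside)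
  · exact le_antisymm (bestBid_le fun l => nonneg_of_bid_lt hab (fun l => (hcross l).2) hinside)
      (le_bestBid hb (by omega) hown)

lemma quote_ne_of_eq_zero (hown : y (k.quote a b) = 0) :
    k.quote (bestAsk N y) (bestBid N y) ≠ k.quote a b := by
  cases k <;> simp only [Side.quote] at hown ⊢
  · refine (Nat.lt_of_succ_le (le_bestAsk (by omega) fun l hl => ?_)).ne'
    rcases (Nat.lt_succ_iff.1 hl).lt_or_eq with hla | rfl
    · exact nonpos_of_lt_ask hab (fun l => (hcross l).1) hinside hla
    · exact hown.le
  · refine Nat.ne_of_lt (Nat.lt_of_le_pred hb (bestBid_le fun l hl => ?_))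
    rcases (Nat.le_of_pred_lt hl).lt_or_eq with hbl | rfl
    · exact nonneg_of_bid_lt hab (fun l => (hcross l).2) hinside hbl
    · exact hown.ge

end Spread

end Quotes

/-! ### One trajectory of the book after the quote time -/

/-- The time at which a queue of size `z` is exhausted. -/
noncomputable def exhaustionTime (z : ℝ≥0 → ℕ) : ℝ≥0∞ :=
  firstTime fun t => z t = 0

/-- The time of the first change of the mid-price along a trajectory of the book. -/
noncomputable def midMove (N : ℕ) (x : ℝ≥0 → Book) : ℝ≥0∞ :=
  firstTime fun u => midPrice N (x u) ≠ midPrice N (x 0)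

/-- The first time at which the opposite queue `β` is exhausted or an order arrives inside the
spread: as long as the order's own queue is not empty, these are the events which move the
mid-price. -/
noncomputable def competingTime {s₀ : ℕ} (β : ℝ≥0 → ℕ) (T : Side → Fin s₀ → ℝ≥0∞) : ℝ≥0∞ :=
  exhaustionTime β ⊓ ⨅ k, ⨅ r, T k r

/-- A trajectory `x` of the book and `w` of the order's position which, up to and including the
first change of the mid-price, are governed by the position `d`, the opposite queue `β` and the
arrival times `T` as in `PostQuoteFlow`. -/
structure IsDrivenPath (N : ℕ) (i : Side) (s₀ a b : ℕ) (x : ℝ≥0 → Book) (w d β : ℝ≥0 → ℕ)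
    (T : Side → Fin s₀ → ℝ≥0∞) : Prop where
  one_le_bid : 1 ≤ b
  ask_le : a ≤ N
  ask_eq : a = b + (s₀ + 1)
  book_right : ∀ t l, ∀ᶠ u in 𝓝[>] t, x u l = x t l
  position_right : ∀ t, ∀ᶠ u in 𝓝[>] t, w u = w t
  position_eq : ∀ u : ℝ≥0, (u : ℝ≥0∞) ≤ midMove N x → w u = d u
  opposite_eq : ∀ u : ℝ≥0, (u : ℝ≥0∞) ≤ midMove N x →
    x u (i.opp.quote a b) = i.opp.sign * (β u : ℤ)
  inside_iff : ∀ u : ℝ≥0, (u : ℝ≥0∞) ≤ midMove N x → ∀ k r,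
    (0 < k.sign * x u (k.insideLevel a b r) ↔ T k r ≤ u)
  own_queue : ∀ u : ℝ≥0, (u : ℝ≥0∞) ≤ midMove N x → (d u : ℤ) ≤ i.sign * x u (i.quote a b)
  no_crossing : ∀ u : ℝ≥0, (u : ℝ≥0∞) ≤ midMove N x → ∀ l,
    (l ≤ b → x u l ≤ 0) ∧ (a ≤ l → 0 ≤ x u l)

/-- The almost sure properties of the drivers: no event at time `0` and no simultaneous events.
Two arrivals on the same side may still coincide, since they move the mid-price in the same
direction. -/
structure IsGenericDriver {s₀ : ℕ} (d β : ℝ≥0 → ℕ) (T : Side → Fin s₀ → ℝ≥0∞) : Prop where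
  position_right : ∀ t, ∀ᶠ u in 𝓝[>] t, d u = d t
  queue_right : ∀ t, ∀ᶠ u in 𝓝[>] t, β u = β t
  position_start : d 0 ≠ 0
  competingTime_pos : 0 < competingTime β T
  arrival_ne_exhaustion : ∀ k r, T k r ≠ ∞ → T k r ≠ exhaustionTime β
  arrival_ne_arrival : ∀ k r r', T k r ≠ ∞ → T k r ≠ T k.opp r'
  fill_ne_competing : exhaustionTime d ≠ ∞ → exhaustionTime d ≠ competingTime β T

section Path

variable {N : ℕ} {i : Side} {s₀ a b : ℕ} {x : ℝ≥0 → Book} {w d β z : ℝ≥0 → ℕ}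
  {T : Side → Fin s₀ → ℝ≥0∞} {u : ℝ≥0}

lemma ne_zero_of_lt_exhaustionTime (h : (u : ℝ≥0∞) < exhaustionTime z) : z u ≠ 0 :=
  not_of_lt_firstTime (A := fun t => z t = 0) h

lemma eq_zero_of_exhaustionTime_eq (hz : ∀ t, ∀ᶠ u in 𝓝[>] t, z u = z t)
    (h : exhaustionTime z = u) : z u = 0 :=
  of_firstTime_eq (p := (· = 0)) (hz u) h

lemma exists_eq_of_iInf_eq_coe {κ : Type*} [Finite κ] {f : κ → ℝ≥0∞} (h : ⨅ k, f k = u) :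
    ∃ k, f k = u := by
  cases isEmpty_or_nonempty κ
  · exact absurd (h.symm.trans (iInf_of_isEmpty f |>.trans sInf_empty)) ENNReal.coe_ne_top
  · exact h ▸ exists_eq_ciInf_of_finite

lemma competingTime_le_exhaustionTime : competingTime β T ≤ exhaustionTime β :=
  inf_le_left

lemma competingTime_le_arrival (k : Side) (r : Fin s₀) : competingTime β T ≤ T k r :=
  inf_le_right.trans ((iInf_le _ k).trans (iInf_le _ r))

lemma exhaustion_or_arrival_of_competingTime_eq (h : competingTime β T = u) :
    exhaustionTime β = u ∨ ∃ k r, T k r = u := by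
  rcases min_choice (exhaustionTime β) (⨅ k, ⨅ r, T k r) with hmin | hmin
  · exact .inl (hmin.symm.trans h)
  · obtain ⟨k, hk⟩ := exists_eq_of_iInf_eq_coe (hmin.symm.trans h)
    exact .inr ⟨k, exists_eq_of_iInf_eq_coe hk⟩

namespace IsDrivenPath

variable (hp : IsDrivenPath N i s₀ a b x w d β T) (hu : (u : ℝ≥0∞) ≤ midMove N x)

include hp hu

lemma own_pos (hd : d u ≠ 0) : 0 < i.sign * x u (i.quote a b) :=
  (Nat.cast_pos.2 (Nat.pos_of_ne_zero hd)).trans_le (hp.own_queue u hu)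

lemma sides_pos (hown : 0 < i.sign * x u (i.quote a b)) (hβ : β u ≠ 0) (k : Side) :
    0 < k.sign * x u (k.quote a b) := by
  have hopp : 0 < i.opp.sign * x u (i.opp.quote a b) := by
    rw [hp.opposite_eq u hu, ← mul_assoc, i.opp.sign_mul_self, one_mul]
    exact_mod_cast Nat.pos_of_ne_zero hβ
  cases i <;> cases k <;> assumption

lemma quote_eq {k : Side} (hT : ∀ r, (u : ℝ≥0∞) < T k r)
    (hk : 0 < k.sign * x u (k.quote a b)) :
    k.quote (bestAsk N (x u)) (bestBid N (x u)) = k.quote a b :=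
  quote_eq_of_pos hp.ask_eq hp.one_le_bid hp.ask_le (hp.no_crossing u hu)
    (fun r => (hp.inside_iff u hu k r).not.2 (hT r).not_ge) hk

lemma midPrice_eq (hown : 0 < i.sign * x u (i.quote a b)) (hM : (u : ℝ≥0∞) < competingTime β T) :
    midPrice N (x u) = ((b : ℝ) + a) / 2 :=
  midPrice_eq_of_quotes fun k => hp.quote_eq hu
    (fun r => hM.trans_le (competingTime_le_arrival k r)) (hp.sides_pos hu hown
      (ne_zero_of_lt_exhaustionTime (hM.trans_le competingTime_le_exhaustionTime)) k)

lemma midPrice_ne_of_exhaustion (hd : d u ≠ 0) (hβ : β u = 0)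
    (hT : ∀ k r, (u : ℝ≥0∞) < T k r) : midPrice N (x u) ≠ ((b : ℝ) + a) / 2 := by
  refine midPrice_ne_of_quotes (k := i.opp) (quote_ne_of_eq_zero hp.ask_eq hp.one_le_bid hp.ask_le
    (hp.no_crossing u hu) (fun r => (hp.inside_iff u hu _ r).not.2 (hT _ r).not_ge) ?_) ?_
  · rw [hp.opposite_eq u hu, hβ, Nat.cast_zero, mul_zero]
  · rw [i.opp_opp]
    exact hp.quote_eq hu (hT i) (hp.own_pos hu hd)

lemma midPrice_ne_of_arrival (hd : d u ≠ 0) (hβ : β u ≠ 0) {k : Side} {r : Fin s₀}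
    (hr : T k r ≤ u) (hopp : ∀ r', (u : ℝ≥0∞) < T k.opp r') :
    midPrice N (x u) ≠ ((b : ℝ) + a) / 2 :=
  midPrice_ne_of_quotes (quote_ne_of_inside_pos hp.ask_eq hp.one_le_bid hp.ask_le
      ((hp.inside_iff u hu k r).2 hr))
    (hp.quote_eq hu hopp (hp.sides_pos hu (hp.own_pos hu hd) hβ _))

lemma midPrice_ne_of_competingTime_eq (hg : IsGenericDriver d β T) (hd : d u ≠ 0)
    (hM : competingTime β T = u) : midPrice N (x u) ≠ ((b : ℝ) + a) / 2 := by
  have arrival_ge (k r) : (u : ℝ≥0∞) ≤ T k r := hM ▸ competingTime_le_arrival k r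
  have exhaustion_ge : (u : ℝ≥0∞) ≤ exhaustionTime β := hM ▸ competingTime_le_exhaustionTime
  rcases exhaustion_or_arrival_of_competingTime_eq hM with hβ | ⟨k, r, hr⟩
  · refine hp.midPrice_ne_of_exhaustion hu hd (eq_zero_of_exhaustionTime_eq hg.queue_right hβ)
      fun k r => (arrival_ge k r).lt_of_ne' fun h => ?_
    exact hg.arrival_ne_exhaustion k r (h ▸ ENNReal.coe_ne_top) (h.trans hβ.symm)
  · have finite : T k r ≠ ∞ := hr ▸ ENNReal.coe_ne_top
    exact hp.midPrice_ne_of_arrival hu hd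
      (ne_zero_of_lt_exhaustionTime
        (exhaustion_ge.lt_of_ne (hr ▸ hg.arrival_ne_exhaustion k r finite)))
      hr.le fun r' => (arrival_ge _ r').lt_of_ne (hr ▸ hg.arrival_ne_arrival k r r' finite)

omit hu

lemma midPrice_zero (hg : IsGenericDriver d β T) : midPrice N (x 0) = ((b : ℝ) + a) / 2 :=
  hp.midPrice_eq zero_le (hp.own_pos zero_le hg.position_start) hg.competingTime_pos

lemma midPrice_ne_zero_of_midMove_eq (h : midMove N x = u) :
    midPrice N (x u) ≠ midPrice N (x 0) :=
  of_firstTime_eq (p := (· ≠ midPrice N (x 0))) (eventually_midPrice_eq hp.book_right u) h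

lemma own_eq_zero_of_midMove_eq (hg : IsGenericDriver d β T) (h : midMove N x = u)
    (hM : (u : ℝ≥0∞) < competingTime β T) : ¬ 0 < i.sign * x u (i.quote a b) := fun hown =>
  hp.midPrice_ne_zero_of_midMove_eq h
    ((hp.midPrice_eq h.ge hown hM).trans (hp.midPrice_zero hg).symm)

lemma midMove_le_competingTime (hg : IsGenericDriver d β T)
    (h : competingTime β T < exhaustionTime d) : midMove N x ≤ competingTime β T := by
  obtain ⟨u, hM, hu⟩ := ENNReal.lt_iff_exists_coe.1 h
  rw [hM]
  by_contra! hlt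
  refine hlt.not_ge (firstTime_le ?_)
  rw [hp.midPrice_zero hg]
  exact hp.midPrice_ne_of_competingTime_eq hlt.le hg (ne_zero_of_lt_exhaustionTime hu) hM

lemma exhaustionTime_le_midMove (hg : IsGenericDriver d β T)
    (h : exhaustionTime d < competingTime β T) : exhaustionTime d ≤ midMove N x := by
  by_contra! hlt
  obtain ⟨u, hu, hud⟩ := ENNReal.lt_iff_exists_coe.1 hlt
  exact hp.own_eq_zero_of_midMove_eq hg hu (hud.trans h)
    (hp.own_pos hu.ge (ne_zero_of_lt_exhaustionTime hud))

lemma exhaustionTime_position_le (hg : IsGenericDriver d β T)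
    (h : exhaustionTime d < competingTime β T) : exhaustionTime w ≤ exhaustionTime d := by
  obtain ⟨e, he, -⟩ := ENNReal.lt_iff_exists_coe.1 h
  have before_move : (e : ℝ≥0∞) ≤ midMove N x := he ▸ hp.exhaustionTime_le_midMove hg h
  rw [he]
  refine firstTime_le ?_
  rw [hp.position_eq e before_move, eq_zero_of_exhaustionTime_eq hg.position_right he]

theorem fill_le_midMove_iff (hg : IsGenericDriver d β T) :
    exhaustionTime w < ∞ ∧ exhaustionTime w ≤ midMove N x ↔
      exhaustionTime d < competingTime β T := by
  constructor
  · rintro ⟨hfin, hle⟩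
    obtain ⟨v, hv, -⟩ := ENNReal.lt_iff_exists_coe.1 hfin
    rw [hv] at hle
    have death_le : exhaustionTime d ≤ v := firstTime_le <| by
      rw [← hp.position_eq v hle, eq_zero_of_exhaustionTime_eq hp.position_right hv]
    by_contra! hM
    have hlt := hM.lt_of_ne' (hg.fill_ne_competing (death_le.trans_lt ENNReal.coe_lt_top).ne)
    exact ((hp.midMove_le_competingTime hg hlt).trans_lt hlt).not_ge (death_le.trans hle)
  · intro h
    have hwd := hp.exhaustionTime_position_le hg h
    exact ⟨(hwd.trans_lt h).trans_le le_top, hwd.trans (hp.exhaustionTime_le_midMove hg h)⟩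

theorem fill_lt_midMove_iff (hg : IsGenericDriver d β T)
    (hne : exhaustionTime w < ∞ → exhaustionTime w ≤ midMove N x →
      x (exhaustionTime w).toNNReal (i.quote a b) ≠ 0) :
    exhaustionTime w < midMove N x ↔ exhaustionTime d < competingTime β T := by
  rw [← hp.fill_le_midMove_iff hg]
  refine ⟨fun h => ⟨h.trans_le le_top, h.le⟩, fun h => h.2.lt_of_ne fun heq => ?_⟩
  obtain ⟨v, hv, -⟩ := ENNReal.lt_iff_exists_coe.1 h.1
  have hlt := (hp.fill_le_midMove_iff hg).1 h
  have move_eq : midMove N x = v := heq.symm.trans hv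
  have own_ne_zero : x v (i.quote a b) ≠ 0 := by simpa [hv] using hne h.1 h.2
  refine hp.own_eq_zero_of_midMove_eq hg move_eq
    (hv ▸ (hp.exhaustionTime_position_le hg hlt).trans_lt hlt) ?_
  exact ((Nat.cast_nonneg _).trans (hp.own_queue v move_eq.ge)).lt_of_ne'
    (mul_ne_zero (by cases i <;> decide) own_ne_zero)

end IsDrivenPath

end Path

/-! ### The law of the drivers -/

lemma eventually_shift {p : ℝ≥0 → Prop} {q t : ℝ≥0} (h : ∀ᶠ v in 𝓝[>] (q + t), p v) :
    ∀ᶠ u in 𝓝[>] t, p (q + u) := by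
  have shift : Tendsto (fun u => q + u) (𝓝[>] t) (𝓝[>] (q + t)) := by
    refine tendsto_nhdsWithin_iff.2 ⟨?_, ?_⟩
    · exact (Continuous.tendsto (by fun_prop) t).mono_left nhdsWithin_le_nhds
    · filter_upwards [self_mem_nhdsWithin] with u (hu : t < u) using add_lt_add_right hu q
  exact shift.eventually h

/-- The random time read off each source of randomness: a first passage time to `0` for the two
queues, and the arrival times themselves. -/
noncomputable def driverTime {Ω : Type*} {s₀ : ℕ} (D B : ℝ≥0 → Ω → ℕ)
    (T : Side → Fin s₀ → Ω → ℝ≥0∞) : Driver s₀ → Ω → ℝ≥0∞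
  | .position => passageTime D
  | .opposite => passageTime B
  | .arrival k r => T k r

/-- The sources of randomness other than the order's position; `none` stands for the opposite
queue. -/
def moveDriver {s₀ : ℕ} : Option (Side × Fin s₀) → Driver s₀
  | none => .opposite
  | some (k, r) => .arrival k r

lemma moveDriver_injective {s₀ : ℕ} : (moveDriver (s₀ := s₀)).Injective := by
  rintro (_ | ⟨k, r⟩) (_ | ⟨k', r'⟩) h <;> simp_all [moveDriver]

lemma moveDriver_ne_position {s₀ : ℕ} (o : Option (Side × Fin s₀)) :
    moveDriver o ≠ .position := by
  rcases o with _ | ⟨k, r⟩ <;> simp [moveDriver]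

lemma competingTime_eq_iInf_driverTime {Ω : Type*} {s₀ : ℕ} (D B : ℝ≥0 → Ω → ℕ)
    (T : Side → Fin s₀ → Ω → ℝ≥0∞) (ω : Ω) :
    competingTime (B · ω) (T · · ω) = ⨅ o, driverTime D B T (moveDriver o) ω := by
  rw [iInf_option, iInf_prod]
  rfl

/-- The total rate at which orders of the two sides arrive inside the spread while the best quotes
are `a` and `b`. It is `2 * Λ` in the case where both sides have the same rate `Λ`. -/
def insideRate {𝒳 : Type*} (R : Intensities 𝒳) (X : ℕ → ℕ → ℕ → 𝒳) (s₀ a b : ℕ) : ℝ≥0 :=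
  ∑ k : Side, ∑ r : Fin s₀, R.lam k 0 (X (k.insideLevel a b r) a b)

lemma two_mul_eq_insideRate {𝒳 : Type*} {R : Intensities 𝒳} {X : ℕ → ℕ → ℕ → 𝒳} {s₀ a b : ℕ}
    {Λ : ℝ} (hask : Λ = ∑ r : Fin s₀, (R.lam .ask 0 (X (Side.ask.insideLevel a b r) a b) : ℝ))
    (hbid : Λ = ∑ r : Fin s₀, (R.lam .bid 0 (X (Side.bid.insideLevel a b r) a b) : ℝ)) :
    2 * Λ = insideRate R X s₀ a b := by
  have sum_sides (f : Side → ℝ≥0) : ∑ k, f k = f .ask + f .bid :=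
    congrArg (f .ask + ·) (add_zero (f .bid))
  rw [insideRate, sum_sides, NNReal.coe_add, NNReal.coe_sum, NNReal.coe_sum, ← hask, ← hbid,
    two_mul]

namespace PostQuoteFlow

variable {Ω 𝒳 : Type*} [MeasurableSpace Ω] {P : Measure Ω} {N : ℕ} {i : Side}
  {Q : ℝ≥0 → Ω → Book} {W : ℝ≥0 → Ω → ℕ} {R : Intensities 𝒳} {X : ℕ → ℕ → ℕ → 𝒳}
  {s₀ a b m n : ℕ} {D B : ℝ≥0 → Ω → ℕ} {T : Side → Fin s₀ → Ω → ℝ≥0∞}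
  (hflow : PostQuoteFlow P N i Q W R X s₀ a b m n D B T)

include hflow

lemma measurable_driverTime : ∀ e, Measurable (driverTime D B T e)
  | .position => hflow.position_law.measurable_passageTime
  | .opposite => hflow.opposite_law.measurable_passageTime
  | .arrival k r => (hflow.arrival_law k r).measurable

lemma measurable_driverSigma_driverTime (e : Driver s₀) :
    Measurable[driverSigma D B T e] (driverTime D B T e) := by
  have measurable_path (Z : ℝ≥0 → Ω → ℕ) (t : ℝ≥0) :
      Measurable[⨆ t, MeasurableSpace.comap (Z t) ⊤] (Z t) :=
    (comap_measurable (Z t)).mono (le_iSup (fun t => MeasurableSpace.comap (Z t) ⊤) t) le_rfl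
  rcases e with _ | _ | ⟨k, r⟩
  · exact measurable_firstTime_mem (measurable_path D) hflow.position_law.right_continuous
      (measurableSet_singleton 0)
  · exact measurable_firstTime_mem (measurable_path B) hflow.opposite_law.right_continuous
      (measurableSet_singleton 0)
  · exact comap_measurable (T k r)

lemma iIndepFun_driverTime : iIndepFun (driverTime D B T) P :=
  iIndepFun_iff_measure_inter_preimage_eq_mul.2 fun _ _ H =>
    hflow.independent.meas_biInter fun e he => hflow.measurable_driverSigma_driverTime e (H e he)

lemma measurable_competingTime : Measurable fun ω => competingTime (B · ω) (T · · ω) := by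
  simp only [competingTime_eq_iInf_driverTime D B T]
  exact .iInf fun o => hflow.measurable_driverTime (moveDriver o)

lemma indepFun_competingTime :
    IndepFun (passageTime D) (fun ω => competingTime (B · ω) (T · · ω)) P := by
  simp only [competingTime_eq_iInf_driverTime D B T]
  exact indepFun_iInf_comp hflow.iIndepFun_driverTime hflow.measurable_driverTime
    (d := .position) moveDriver_ne_position

lemma ae_fill_ne_competing [IsFiniteMeasure P] (hm : m ≠ 0) :
    ∀ᵐ ω ∂P, passageTime D ω ≠ ∞ → passageTime D ω ≠ competingTime (B · ω) (T · · ω) :=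
  ae_ne_of_indepFun hflow.position_law.measurable_passageTime hflow.measurable_competingTime
    hflow.indepFun_competingTime (hflow.position_law.measure_passageTime_eq hm)

lemma ae_arrival_ne [IsProbabilityMeasure P] {k : Side} {r : Fin s₀} {e : Driver s₀}
    (he : .arrival k r ≠ e) : ∀ᵐ ω ∂P, T k r ω ≠ ∞ → T k r ω ≠ driverTime D B T e ω :=
  ae_ne_of_indepFun (hflow.arrival_law k r).measurable (hflow.measurable_driverTime e)
    (hflow.iIndepFun_driverTime.indepFun he) (hflow.arrival_law k r).measure_eq

lemma measureReal_lt_competingTime (t : ℝ≥0) :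
    P.real {ω | (t : ℝ≥0∞) < competingTime (B · ω) (T · · ω)}
      = P.real {ω | (t : ℝ≥0∞) < passageTime B ω}
        * Real.exp (-(insideRate R X s₀ a b * t)) := by
  simp only [competingTime_eq_iInf_driverTime D B T]
  rw [measureReal_lt_iInf (hflow.iIndepFun_driverTime.precomp moveDriver_injective)
    ENNReal.coe_lt_top, Fintype.prod_option, Fintype.prod_prod_type]
  simp only [insideRate, NNReal.coe_sum, Finset.sum_mul, ← Finset.sum_neg_distrib, Real.exp_sum]
  exact congrArg _ (Fintype.prod_congr _ _ fun k => Fintype.prod_congr _ _ fun r =>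
    (hflow.arrival_law k r).tail t)

lemma survival_competingTime {t : ℝ} (ht : 0 < t) :
    survival P (fun ω => competingTime (B · ω) (T · · ω)) t = survival P (passageTime B) t
      * Real.exp (-(insideRate R X s₀ a b * t)) := by
  have tail := hflow.measureReal_lt_competingTime t.toNNReal
  rwa [Real.coe_toNNReal t ht.le] at tail

lemma ae_competingTime_pos [IsProbabilityMeasure P] (hn : n ≠ 0) :
    ∀ᵐ ω ∂P, 0 < competingTime (B · ω) (T · · ω) := by
  have exhaustion_ne : ∀ᵐ ω ∂P, passageTime B ω ≠ 0 :=
    ae_iff.2 <| by simpa using hflow.opposite_law.measure_passageTime_eq hn 0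
  have arrival_ne : ∀ᵐ ω ∂P, ∀ k r, T k r ω ≠ 0 := ae_all_iff.2 fun k => ae_all_iff.2 fun r =>
    ae_iff.2 <| by simpa using (hflow.arrival_law k r).measure_eq 0
  filter_upwards [exhaustion_ne, arrival_ne] with ω hB hT
  refine pos_iff_ne_zero.2 fun h => ?_
  rcases exhaustion_or_arrival_of_competingTime_eq (u := 0) h with hB' | ⟨k, r, hr⟩
  · exact hB hB'
  · exact hT k r hr

lemma ae_isGenericDriver [IsProbabilityMeasure P] (hm : m ≠ 0) (hn : n ≠ 0) :
    ∀ᵐ ω ∂P, IsGenericDriver (D · ω) (B · ω) (T · · ω) := by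
  have arrival_ne_exhaustion : ∀ᵐ ω ∂P, ∀ k r, T k r ω ≠ ∞ → T k r ω ≠ passageTime B ω :=
    ae_all_iff.2 fun k => ae_all_iff.2 fun r => hflow.ae_arrival_ne (e := .opposite) (by simp)
  have arrival_ne_arrival : ∀ᵐ ω ∂P, ∀ k r r', T k r ω ≠ ∞ → T k r ω ≠ T k.opp r' ω :=
    ae_all_iff.2 fun k => ae_all_iff.2 fun r => ae_all_iff.2 fun r' =>
      hflow.ae_arrival_ne (e := .arrival k.opp r') (by cases k <;> simp [Side.opp])
  filter_upwards [arrival_ne_exhaustion, arrival_ne_arrival, hflow.ae_fill_ne_competing hm,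
    hflow.ae_competingTime_pos hn, hflow.position_law.start] with ω hTB hTT hD hpos hstart
  exact
    { position_right := hflow.position_law.right_continuous ω
      queue_right := hflow.opposite_law.right_continuous ω
      position_start := hstart ▸ hm
      competingTime_pos := hpos
      arrival_ne_exhaustion := hTB
      arrival_ne_arrival := hTT
      fill_ne_competing := hD }

lemma ae_isDrivenPath (hb : 1 ≤ b) (ha : a ≤ N) (hab : a = b + (s₀ + 1))
    (hQr : ∀ ω t l, ∀ᶠ u in 𝓝[>] t, Q u ω l = Q t ω l)
    (hWr : ∀ ω t, ∀ᶠ u in 𝓝[>] t, W u ω = W t ω) :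
    ∀ᵐ ω ∂P, IsDrivenPath N i s₀ a b (shiftedBook N i Q · ω) (shiftedPosition N i Q W · ω)
      (D · ω) (B · ω) (T · · ω) := by
  filter_upwards [hflow.position_eq, hflow.opposite_eq, hflow.inside_iff, hflow.own_queue,
    hflow.no_crossing] with ω hposition hopposite hinside hown hcross
  exact
    { one_le_bid := hb
      ask_le := ha
      ask_eq := hab
      book_right := fun t l => eventually_shift (hQr ω _ l)
      position_right := fun t => eventually_shift (p := fun v => W v ω = W (_ + t) ω) (hWr ω _)
      position_eq := hposition
      opposite_eq := hopposite
      inside_iff := hinside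
      own_queue := hown
      no_crossing := hcross }

lemma hasInverseLaplaceAt_lt_competingTime [IsProbabilityMeasure P] (hm : m ≠ 0) {Λ c : ℝ}
    (hΛ : 2 * Λ = insideRate R X s₀ a b) (hc : 0 < c)
    (hconv : c < 2 * Λ ∨
      (2 * Λ < c ∧ (∀ᵐ ω ∂P, passageTime B ω < ∞) ∧
        Integrable (fun ω => Real.exp ((c - 2 * Λ) * (passageTime B ω).toReal)) P)) :
    HasInverseLaplaceAt (fillTransform (laplace P (passageTime D)) (laplace P (passageTime B)) Λ)
      c 0 (P.real {ω | passageTime D ω < competingTime (B · ω) (T · · ω)}) := by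
  have hσ := hflow.opposite_law.measurable_passageTime
  have hint : IntegrableOn (fun t => Real.exp ((c - 2 * Λ) * t) * survival P (passageTime B) t)
      (Set.Ioi 0) := by
    rcases hconv with hlt | ⟨hlt, hfin, hexp⟩
    · exact integrableOn_survival_of_neg (sub_neg.2 hlt)
    · exact integrableOn_survival_of_integrable_exp hσ (sub_pos.2 hlt).ne' hfin hexp
  exact hasInverseLaplaceAt_fillTransform hflow.position_law.measurable_passageTime hσ
    hflow.measurable_competingTime hflow.indepFun_competingTime (hflow.ae_fill_ne_competing hm) hc
    (hconv.elim LT.lt.ne fun h => h.1.ne') (fun t ht => hΛ ▸ hflow.survival_competingTime ht) hint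

end PostQuoteFlow

end LimitOrderBook

theorem mainTheorem5_general {Ω : Type*} [MeasurableSpace Ω] {𝒳 : Type*}
    (P : Measure Ω) [IsProbabilityMeasure P]
    (N : ℕ) (i : Side) (Q : ℝ≥0 → Ω → Book) (W : ℝ≥0 → Ω → ℕ)
    (hQr : ∀ ω t l, ∀ᶠ u in 𝓝[>] t, Q u ω l = Q t ω l)
    (hWr : ∀ ω t, ∀ᶠ u in 𝓝[>] t, W u ω = W t ω)
    (R : Intensities 𝒳) (X : ℕ → ℕ → ℕ → 𝒳)
    (s₀ a b m n : ℕ) (hb : 1 ≤ b) (ha : a ≤ N) (hab : a = b + (s₀ + 1)) (hm : 1 ≤ m) (hn : 1 ≤ n)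
    (D B : ℝ≥0 → Ω → ℕ) (T : Side → Fin s₀ → Ω → ℝ≥0∞)
    (hflow : PostQuoteFlow P N i Q W R X s₀ a b m n D B T)
    (Λ : ℝ) (hΛ : 2 * Λ = insideRate R X s₀ a b)
    (c : ℝ) (hc : 0 < c)
    (hconv : c < 2 * Λ ∨
      (2 * Λ < c ∧ (∀ᵐ ω ∂P, passageTime B ω < ∞) ∧
        Integrable (fun ω => Real.exp ((c - 2 * Λ) * (passageTime B ω).toReal)) P)) :
    HasInverseLaplaceAt
      (fillTransform (laplace P (passageTime D)) (laplace P (passageTime B)) Λ) c 0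
      (P.real {ω | fillTime N i Q W ω < ∞ ∧ fillTime N i Q W ω ≤ nextMove N i Q ω} : ℝ) ∧
    ((∀ᵐ ω ∂P, fillTime N i Q W ω < ∞ → fillTime N i Q W ω ≤ nextMove N i Q ω →
        shiftedBook N i Q (fillTime N i Q W ω).toNNReal ω (i.quote a b) ≠ 0) →
      HasInverseLaplaceAt
        (fillTransform (laplace P (passageTime D)) (laplace P (passageTime B)) Λ) c 0
        (P.real {ω | fillTime N i Q W ω < nextMove N i Q ω} : ℝ)) := by
  have inversion := hflow.hasInverseLaplaceAt_lt_competingTime (by lia) hΛ hc hconv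
  have generic := hflow.ae_isGenericDriver (by lia) (by lia)
  have driven := hflow.ae_isDrivenPath hb ha hab hQr hWr
  refine ⟨?_, fun hne => ?_⟩
  · rwa [measureReal_congr]
    filter_upwards [driven, generic] with ω hp hg using propext (hp.fill_le_midMove_iff hg)
  · rwa [measureReal_congr]
    filter_upwards [driven, generic, hne] with ω hp hg hω
      using propext (hp.fill_lt_midMove_iff hg hω)

theorem mainTheorem5 {Ω : Type*} [MeasurableSpace Ω] {𝒳 : Type*}
    (P : Measure Ω) [IsProbabilityMeasure P]
    -- the grid, the side `i` of the order, the book and the order's queue position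
    (N : ℕ) (i : Side) (Q : ℝ≥0 → Ω → Book) (W : ℝ≥0 → Ω → ℕ)
    (hQ : ∀ t, Measurable (Q t)) (hW : ∀ t, Measurable (W t))
    (hQr : ∀ ω t l, ∀ᶠ u in 𝓝[>] t, Q u ω l = Q t ω l)
    (hWr : ∀ ω t, ∀ᶠ u in 𝓝[>] t, W u ω = W t ω)
    -- the intensities and the factor vectors
    (R : Intensities 𝒳) (X : ℕ → ℕ → ℕ → 𝒳)
    -- the initial spread, and the state at the quote time, when the spread is `s₀ + 1`
    (s₀ a b m n : ℕ) (hs₀ : 1 ≤ s₀) (hb : 1 ≤ b) (ha : a ≤ N) (hab : a = b + (s₀ + 1))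
    (hm : 1 ≤ m) (hn : 1 ≤ n)
    (hC : P (quoteEvent N i Q W s₀ a b m n) ≠ 0)
    -- the conditional law given the state at the quote time
    (P' : Measure Ω) (hP' : P' = P[|quoteEvent N i Q W s₀ a b m n])
    -- the order flow after the quote time
    (D B : ℝ≥0 → Ω → ℕ) (T : Side → Fin s₀ → Ω → ℝ≥0∞)
    (hflow : PostQuoteFlow P' N i Q W R X s₀ a b m n D B T)
    -- the total arrival rate inside the spread, the same on both sides
    (Λ : ℝ)
    (hΛask : Λ = ∑ r : Fin s₀, (R.lam .ask 0 (X (a - ((r : ℕ) + 1)) a b) : ℝ))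
    (hΛbid : Λ = ∑ r : Fin s₀, (R.lam .bid 0 (X (b + ((r : ℕ) + 1)) a b) : ℝ))
    -- the inversion line lies in the domain of convergence of the transform
    (c : ℝ) (hc : 0 < c)
    (hconv : c < 2 * Λ ∨
      (2 * Λ < c ∧ (∀ᵐ ω ∂P', passageTime B ω < ∞) ∧
        Integrable (fun ω => Real.exp ((c - 2 * Λ) * (passageTime B ω).toReal)) P')) :
    -- the order is filled with no earlier mid-price move
    HasInverseLaplaceAt
      (fillTransform (laplace P' (passageTime D)) (laplace P' (passageTime B)) Λ) c 0
      (P'.real {ω | fillTime N i Q W ω < ∞ ∧ fillTime N i Q W ω ≤ nextMove N i Q ω} : ℝ) ∧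
    -- if the fill does not itself empty the order's level: strictly before the next move
    ((∀ᵐ ω ∂P', fillTime N i Q W ω < ∞ → fillTime N i Q W ω ≤ nextMove N i Q ω →
        shiftedBook N i Q (fillTime N i Q W ω).toNNReal ω (i.quote a b) ≠ 0) →
      HasInverseLaplaceAt
        (fillTransform (laplace P' (passageTime D)) (laplace P' (passageTime B)) Λ) c 0
        (P'.real {ω | fillTime N i Q W ω < nextMove N i Q ω} : ℝ)) := by
  have : IsProbabilityMeasure P' := hP' ▸ cond_isProbabilityMeasure hC
  exact mainTheorem5_general P' N i Q W hQr hWr R X s₀ a b m n hb ha hab hm hn D B T hflow Λ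
    (two_mul_eq_insideRate hΛask hΛbid) c hc hconv
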